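/- Let $\Omega,\tilde\Omega\subset\mathbb{R}^n$ be bounded, uniformly convex domains with smooth boundary (nonempty, open, convex, with principal curvatures of the boundary bounded below by a positive constant), and suppose $\overline{\tilde\Omega}\subset B_1(0)$. Then there is a constant $C_1>0$, depending only on $\Omega$ and $\tilde\Omega$, with the following property. Let $c\in\mathbb{R}$ and let $u\in C^2(\overline\Omega)$ be strictly convex in $\Omega$ with $|Du|<1$ in $\Omega$ and $$\mathrm{div}\left(\frac{Du}{\sqrt{1-|Du|^2}}\right)=c\ \text{ in }\Omega,\qquad Du(\Omega)=\tilde\Omega .$$ Let $h:\mathbb{R}^n\to\mathbb{R}$ be a defining function of $\tilde\Omega$, that is, $h$ is smooth, $\tilde\Omega=\{p: h(p)>0\}$, $|Dh|=1$ on $\partial\tilde\Omega$, and there is $\theta>0$ with $\sum_{i,j}\frac{\partial^2h}{\partial p_i\partial p_j}(p)\,\xi_i\xi_j\le-\theta|\xi|^2$ for all $p\in\tilde\Omega$, $\xi\in\mathbb{R}^n$. Put $\beta(x)=Dh(Du(x))$ and let $\nu(x)$ be the inner unit normal of $\partial\Omega$ at $x\in\partial\Omega$. Then $$\langle\beta,\nu\rangle\ge\frac1{C_1}>0\quad\text{on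 }\partial\Omega .$$ -/

import Mathlib

open scoped ContDiff

/-- `ρ` is a smooth local defining function of `Ω` at the point `x`: near `x` the set `Ω` is
`{ρ > 0}`, and the gradient of `ρ` does not vanish at `x`. -/
def IsLocalDefiningFunction {n : ℕ} (Ω : Set (EuclideanSpace ℝ (Fin n)))
    (x : EuclideanSpace ℝ (Fin n)) (ρ : EuclideanSpace ℝ (Fin n) → ℝ) : Prop :=
  ContDiff ℝ ∞ ρ ∧ gradient ρ x ≠ 0 ∧ ∀ᶠ y in nhds x, (y ∈ Ω ↔ 0 < ρ y)

/-- A bounded uniformly convex domain with smooth boundary: a nonempty bounded open convex set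
which near every boundary point is the positivity set of a smooth local defining function, and
whose boundary has principal curvatures bounded below by a constant `κ > 0`. With respect to the
inner normal `∇ρ / |∇ρ|`, the second fundamental form of `{ρ = 0}` is `- D²ρ(ξ, ξ) / |∇ρ|` on
tangent vectors `ξ ⟂ ∇ρ`. -/
structure IsUniformlyConvexDomain {n : ℕ} (Ω : Set (EuclideanSpace ℝ (Fin n))) : Prop where
  isOpen : IsOpen Ω
  nonempty : Ω.Nonempty
  isBounded : Bornology.IsBounded Ω
  convex : Convex ℝ Ω
  curvature : ∃ κ : ℝ, 0 < κ ∧ ∀ x ∈ frontier Ω, ∃ ρ : EuclideanSpace ℝ (Fin n) → ℝ,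
    IsLocalDefiningFunction Ω x ρ ∧
      ∀ ξ : EuclideanSpace ℝ (Fin n), inner ℝ (gradient ρ x) ξ = 0 →
        κ * ‖gradient ρ x‖ * ‖ξ‖ ^ 2 ≤ -(fderiv ℝ (fderiv ℝ ρ) x ξ ξ)

/-- `ν` is the inner unit normal of `∂Ω` at `x ∈ ∂Ω`. -/
def IsInnerUnitNormal {n : ℕ} (Ω : Set (EuclideanSpace ℝ (Fin n)))
    (x ν : EuclideanSpace ℝ (Fin n)) : Prop :=
  ∃ ρ : EuclideanSpace ℝ (Fin n) → ℝ, IsLocalDefiningFunction Ω x ρ ∧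
    ν = ‖gradient ρ x‖⁻¹ • gradient ρ x

/-- `h` is a defining function of the domain `Ω'`: it is smooth, `Ω' = {h > 0}`, `|Dh| = 1` on
`∂Ω'`, and `D²h ≤ -θ I` on `Ω'` for some `θ > 0`. -/
structure IsDefiningFunction {n : ℕ} (Ω' : Set (EuclideanSpace ℝ (Fin n)))
    (h : EuclideanSpace ℝ (Fin n) → ℝ) : Prop where
  smooth : ContDiff ℝ ∞ h
  eq_pos : Ω' = {p | 0 < h p}
  norm_gradient : ∀ p ∈ frontier Ω', ‖gradient h p‖ = 1
  concave : ∃ θ : ℝ, 0 < θ ∧ ∀ p ∈ Ω', ∀ ξ : EuclideanSpace ℝ (Fin n),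
    fderiv ℝ (fderiv ℝ h) p ξ ξ ≤ -θ * ‖ξ‖ ^ 2

/-- The gradient `Du` up to the boundary of a function on the closure of `Ω` (on the open set `Ω`
it is the usual gradient, on `∂Ω` its continuous extension when `u` is `C¹` up to the boundary of
a convex domain). -/
noncomputable def gradientUpTo {n : ℕ} (Ω : Set (EuclideanSpace ℝ (Fin n)))
    (u : EuclideanSpace ℝ (Fin n) → ℝ) (x : EuclideanSpace ℝ (Fin n)) :
    EuclideanSpace ℝ (Fin n) :=
  gradientWithin u (closure Ω) x

/-- The divergence `∑ᵢ ∂ᵢ Vᵢ` of a vector field. -/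
noncomputable def divergence {n : ℕ}
    (V : EuclideanSpace ℝ (Fin n) → EuclideanSpace ℝ (Fin n))
    (x : EuclideanSpace ℝ (Fin n)) : ℝ :=
  ∑ i : Fin n, (fderiv ℝ V x (EuclideanSpace.single i 1)) i

/-- `u` is a strictly convex solution, of class `C²` up to the boundary, of the second boundary
value problem `div (Du / √(1 - |Du|²)) = c` in `Ω`, `Du(Ω) = Ω'`. -/
structure IsStrictlyConvexSolution {n : ℕ} (Ω Ω' : Set (EuclideanSpace ℝ (Fin n))) (c : ℝ)
    (u : EuclideanSpace ℝ (Fin n) → ℝ) : Prop where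
  contDiffOn : ContDiffOn ℝ 2 u (closure Ω)
  strictConvexOn : StrictConvexOn ℝ Ω u
  spacelike : ∀ x ∈ Ω, ‖gradientUpTo Ω u x‖ < 1
  equation : ∀ x ∈ Ω,
    divergence
      (fun y => (√(1 - ‖gradientUpTo Ω u y‖ ^ 2))⁻¹ • gradientUpTo Ω u y) x = c
  image_gradient : gradientUpTo Ω u '' Ω = Ω'

/-! Fix $x\in\partial\Omega$, put $e=\beta(x)$ and study $v=D_eu$. Since
$Du(x)\in\partial\tilde\Omega$ and $e$ is an inner normal of the convex set $\tilde\Omega$ there,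
$v$ attains its minimum over $\overline\Omega$ at $x$. So $A=D^2u(x)$ satisfies
$A(\xi,e)=A(\nu,e)\langle\nu,\xi\rangle$ for all $\xi$, and Cauchy-Schwarz for $A\ge0$ gives
$A(\nu,e)^2\le A(\nu,\nu)A(e,e)=A(\nu,\nu)A(\nu,e)\langle\nu,e\rangle$. Hence
$\langle\beta,\nu\rangle\ge A(\nu,e)/A(\nu,\nu)$ as soon as $A(\nu,e)>0$, and two uniform bounds
remain.

Upper bound: convexity and the equation give $\mathrm{tr}\,D^2u\le c$ (`bilinTrace_le`), and
touching $u$ from above by a paraboloid inside a fixed ball bounds $c$ (`mul_sqrt_le`).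

Lower bound: $A(\nu,e)$ is the normal derivative of $v$ at its minimum, so a quantitative Hopf lemma
is needed. As $\tilde\Omega$ contains a fixed ball, $v-v(x)$ is bounded below somewhere in $\Omega$.
Exponential barriers on annuli carry this positivity along a chain of balls to the interior ball
touching at $x$, then to $x$ (`barrier_le_fderiv`, `chain_le_fderiv`, `growth_le_fderiv`). Since $u$
is only $C^2$, the equation is never differentiated: the barrier is compared with the increments
$u(\cdot+te)-u$, and $t\to0$ at the end. -/

open Filter Topology Set Metric

/-! ### One-variable calculus and Cauchy-Schwarz -/

/-- First and second order necessary conditions at a local minimum of a function of one variable. -/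
theorem IsLocalMin.deriv_eq_zero_and_snd_deriv_nonneg {g g' : ℝ → ℝ} {k x : ℝ}
    (hmin : IsLocalMin g x) (hg : ∀ᶠ s in 𝓝 x, HasDerivAt g (g' s) s)
    (hg' : HasDerivAt g' k x) : g' x = 0 ∧ 0 ≤ k := by
  have h0 : g' x = 0 := hmin.hasDerivAt_eq_zero hg.self_of_nhds
  refine ⟨h0, ?_⟩
  by_contra! hk
  have hd : deriv g =ᶠ[𝓝 x] g' := hg.mono fun s hs => hs.deriv
  have hdd : deriv (deriv g) x = k := by rw [hd.deriv_eq]; exact hg'.deriv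
  -- A negative second derivative makes the point a local maximum as well, so $g$ is locally
  -- constant and its second derivative vanishes.
  have hmax : IsLocalMax g x :=
    isLocalMax_of_deriv_deriv_neg (by rw [hdd]; exact hk) (by rw [hd.self_of_nhds, h0])
      hg.self_of_nhds.continuousAt
  have hc : g =ᶠ[𝓝 x] fun _ => g x := by
    filter_upwards [hmin, hmax] with s h1 h2 using le_antisymm h2 h1
  have h1 : deriv g =ᶠ[𝓝 x] fun _ => 0 := by
    simpa using hc.deriv
  have : deriv (deriv g) x = 0 := by rw [h1.deriv_eq]; simp
  linarith

/-- A function dominating another one to the right of a point where they agree has the larger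
right derivative. -/
theorem HasDerivWithinAt.le_of_eventually_le {f g : ℝ → ℝ} {f' g' : ℝ}
    (hf : HasDerivWithinAt f f' (Ioi 0) 0) (hg : HasDerivWithinAt g g' (Ioi 0) 0)
    (hle : ∀ᶠ s in 𝓝[>] (0 : ℝ), g s - g 0 ≤ f s - f 0) : g' ≤ f' := by
  rw [hasDerivWithinAt_iff_tendsto_slope' (by simp)] at hf hg
  refine le_of_tendsto_of_tendsto hg hf ?_
  filter_upwards [hle, self_mem_nhdsWithin] with s hs hs0
  have : (0 : ℝ) < s := hs0
  simp only [slope_def_field, sub_zero]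
  gcongr

/-- Cauchy-Schwarz for a symmetric positive semidefinite bilinear form. -/
theorem sq_apply_le_of_symm_of_nonneg {V : Type*} [NormedAddCommGroup V] [NormedSpace ℝ V]
    (B : V →L[ℝ] V →L[ℝ] ℝ) (hs : ∀ ξ η, B ξ η = B η ξ) (hp : ∀ ξ, 0 ≤ B ξ ξ) (ξ η : V) :
    B ξ η ^ 2 ≤ B ξ ξ * B η η := by
  have h : ∀ s : ℝ, 0 ≤ B η η * (s * s) + (2 * B ξ η) * s + B ξ ξ := by
    intro s
    have := hp (ξ + s • η)
    simp only [map_add, map_smul, add_apply, smul_apply,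
      smul_eq_mul] at this
    rw [hs η ξ] at this
    linarith
  have := discrim_le_zero h
  unfold discrim at this
  nlinarith

/-! ### Trace bounds for semidefinite forms -/

section Trace

variable {n : ℕ}

local notation "𝔼" => EuclideanSpace ℝ (Fin n)

/-- The trace of a bilinear form on Euclidean space. -/
noncomputable def bilinTrace (B : 𝔼 →L[ℝ] 𝔼 →L[ℝ] ℝ) : ℝ :=
  ∑ i, B (EuclideanSpace.single i 1) (EuclideanSpace.single i 1)

theorem EuclideanSpace.sum_smul_single (ξ : 𝔼) :
    ∑ i, ξ i • EuclideanSpace.single i (1 : ℝ) = ξ := by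
  ext j
  simp [Pi.single_apply]

theorem sum_mul_apply_single (f : 𝔼 →L[ℝ] ℝ) (ξ : 𝔼) :
    ∑ i, ξ i * f (EuclideanSpace.single i 1) = f ξ := by
  conv_rhs => rw [← EuclideanSpace.sum_smul_single ξ]
  simp

theorem bilinTrace_nonneg {B : 𝔼 →L[ℝ] 𝔼 →L[ℝ] ℝ} (hp : ∀ ξ, 0 ≤ B ξ ξ) : 0 ≤ bilinTrace B :=
  Finset.sum_nonneg fun _ _ => hp _

/-- Testing $B\ge0$ on $\xi_ib_j-\xi_jb_i$ and summing over all pairs $i,j$ gives the bound without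
diagonalizing $B$. -/
theorem apply_self_le_bilinTrace_mul {B : 𝔼 →L[ℝ] 𝔼 →L[ℝ] ℝ} (hs : ∀ ξ η, B ξ η = B η ξ)
    (hp : ∀ ξ, 0 ≤ B ξ ξ) (ξ : 𝔼) : B ξ ξ ≤ bilinTrace B * ‖ξ‖ ^ 2 := by
  set b : Fin n → 𝔼 := fun i => EuclideanSpace.single i (1 : ℝ) with hb
  have hexp : B ξ ξ = ∑ i, ∑ j, ξ i * (ξ j * B (b i) (b j)) := by
    rw [← ContinuousLinearMap.flip_apply, ← sum_mul_apply_single (B.flip ξ) ξ]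
    refine Finset.sum_congr rfl fun i _ => ?_
    rw [ContinuousLinearMap.flip_apply, ← sum_mul_apply_single (B _) ξ, Finset.mul_sum]
  have hpair : ∀ i j, 2 * (ξ i * (ξ j * B (b i) (b j))) ≤
      ξ i ^ 2 * B (b j) (b j) + ξ j ^ 2 * B (b i) (b i) := by
    intro i j
    have := hp (ξ i • b j - ξ j • b i)
    simp only [map_sub, map_smul, sub_apply, smul_apply,
      smul_eq_mul] at this
    rw [hs (b j) (b i)] at this
    nlinarith
  have hn : ‖ξ‖ ^ 2 = ∑ i, ξ i ^ 2 := EuclideanSpace.real_norm_sq_eq ξ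
  have h2 : 2 * B ξ ξ ≤ 2 * (bilinTrace B * ‖ξ‖ ^ 2) := by
    calc 2 * B ξ ξ = ∑ i, ∑ j, 2 * (ξ i * (ξ j * B (b i) (b j))) := by
          rw [hexp]; simp only [Finset.mul_sum]
      _ ≤ ∑ i, ∑ j, (ξ i ^ 2 * B (b j) (b j) + ξ j ^ 2 * B (b i) (b i)) :=
          Finset.sum_le_sum fun i _ => Finset.sum_le_sum fun j _ => hpair i j
      _ = 2 * (bilinTrace B * ‖ξ‖ ^ 2) := by
          simp only [Finset.sum_add_distrib]
          rw [Finset.sum_comm (f := fun i j => ξ j ^ 2 * B (b i) (b i)), hn, bilinTrace,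
            Finset.sum_mul_sum, Finset.sum_comm]
          rw [two_mul]
          congr 1 <;>
          exact Finset.sum_congr rfl fun i _ => Finset.sum_congr rfl fun j _ => mul_comm _ _
  linarith

theorem abs_apply_le_bilinTrace_mul {B : 𝔼 →L[ℝ] 𝔼 →L[ℝ] ℝ} (hs : ∀ ξ η, B ξ η = B η ξ)
    (hp : ∀ ξ, 0 ≤ B ξ ξ) (ξ η : 𝔼) : |B ξ η| ≤ bilinTrace B * ‖ξ‖ * ‖η‖ := by
  have hT := bilinTrace_nonneg hp
  refine abs_le_of_sq_le_sq ?_ (by positivity)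
  calc B ξ η ^ 2 ≤ B ξ ξ * B η η := sq_apply_le_of_symm_of_nonneg B hs hp ξ η
    _ ≤ (bilinTrace B * ‖ξ‖ ^ 2) * (bilinTrace B * ‖η‖ ^ 2) :=
        mul_le_mul (apply_self_le_bilinTrace_mul hs hp ξ) (apply_self_le_bilinTrace_mul hs hp η)
          (hp η) (by positivity)
    _ = _ := by ring

end Trace

/-! ### Inner normals and the uniform interior sphere condition -/

section Normal

variable {n : ℕ} {Ω : Set (EuclideanSpace ℝ (Fin n))} {x : EuclideanSpace ℝ (Fin n)}
  {ρ : EuclideanSpace ℝ (Fin n) → ℝ}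

local notation "𝔼" => EuclideanSpace ℝ (Fin n)

theorem inner_gradient_eq_fderiv (f : 𝔼 → ℝ) (x ξ : 𝔼) :
    inner ℝ (gradient f x) ξ = fderiv ℝ f x ξ := by
  simp [gradient]

/-- A functional that is nonnegative on an open half space is a multiple of the functional
defining the half space. -/
theorem apply_eq_mul_inner_of_nonneg {ν : 𝔼} (hν : ‖ν‖ = 1) {l : 𝔼 →L[ℝ] ℝ}
    (hl : ∀ ξ, 0 < inner ℝ ν ξ → 0 ≤ l ξ) (ξ : 𝔼) : l ξ = l ν * inner ℝ ν ξ := by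
  have hνν : inner ℝ ν ν = (1 : ℝ) := by rw [real_inner_self_eq_norm_sq, hν]; norm_num
  -- A vector of the boundary hyperplane is tilted into the open half space by a small multiple of
  -- $\nu$. Applied to $\pm\eta$, this shows that $l$ vanishes on the hyperplane.
  have key : ∀ η, inner ℝ ν η = (0 : ℝ) → 0 ≤ l η := by
    intro η hη
    have hlν : 0 ≤ l ν := hl ν (by rw [hνν]; norm_num)
    refine le_of_forall_pos_le_add fun ε hε => ?_
    have h1 := hl (η + (ε / (l ν + 1)) • ν) (by
      rw [inner_add_right, inner_smul_right, hη, hνν]; positivity)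
    rw [map_add, map_smul, smul_eq_mul] at h1
    have h2 : ε / (l ν + 1) * l ν ≤ ε := by
      rw [div_mul_eq_mul_div, div_le_iff₀ (by positivity)]; nlinarith
    linarith
  have horth : inner ℝ ν (ξ - (inner ℝ ν ξ : ℝ) • ν) = (0 : ℝ) := by
    rw [inner_sub_right, inner_smul_right, hνν]; ring
  have h1 := key _ horth
  have h2 := key (-(ξ - (inner ℝ ν ξ : ℝ) • ν)) (by rw [inner_neg_right, horth, neg_zero])
  rw [map_neg] at h2
  have h3 : l (ξ - (inner ℝ ν ξ : ℝ) • ν) = 0 := by linarith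
  rw [map_sub, map_smul, smul_eq_mul] at h3
  linarith

theorem IsLocalDefiningFunction.eq_zero (hΩ : IsOpen Ω) (hx : x ∈ frontier Ω)
    (h : IsLocalDefiningFunction Ω x ρ) : ρ x = 0 := by
  obtain ⟨hsm, -, hev⟩ := h
  rw [hΩ.frontier_eq] at hx
  refine le_antisymm (not_lt.1 fun hpos => hx.2 (hev.self_of_nhds.2 hpos)) ?_
  by_contra! hneg
  have h1 : ∀ᶠ y in 𝓝 x, ρ y < 0 := hsm.continuous.continuousAt.eventually_lt_const hneg
  obtain ⟨y, hy, hyΩ⟩ := (mem_closure_iff_frequently.1 hx.1).and_eventually (h1.and hev) |>.exists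
  exact absurd (hyΩ.2.1 hy) (not_lt.2 hyΩ.1.le)

theorem IsLocalDefiningFunction.eventually_mem (hΩ : IsOpen Ω) (hx : x ∈ frontier Ω)
    (h : IsLocalDefiningFunction Ω x ρ) {ξ : 𝔼} (hξ : 0 < inner ℝ (gradient ρ x) ξ) :
    ∀ᶠ s in 𝓝[>] (0 : ℝ), x + s • ξ ∈ Ω := by
  have h0 := h.eq_zero hΩ hx
  obtain ⟨hsm, -, hev⟩ := h
  rw [inner_gradient_eq_fderiv] at hξ
  have hline : HasDerivAt (fun s : ℝ => x + s • ξ) ξ 0 := by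
    simpa using ((hasDerivAt_id (0 : ℝ)).smul_const ξ).const_add x
  have hd : HasDerivAt (fun s : ℝ => ρ (x + s • ξ)) (fderiv ℝ ρ x ξ) 0 := by
    have h1 : HasFDerivAt ρ (fderiv ℝ ρ x) (x + (0 : ℝ) • ξ) := by
      simpa using (hsm.differentiable (by simp)).differentiableAt.hasFDerivAt
    exact h1.comp_hasDerivAt (0 : ℝ) hline
  have h1 : ∀ᶠ s in 𝓝[>] (0 : ℝ), 0 < slope (fun s : ℝ => ρ (x + s • ξ)) 0 s :=
    ((hasDerivAt_iff_tendsto_slope.1 hd).mono_left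
      (nhdsWithin_mono _ fun s (hs : (0 : ℝ) < s) => hs.ne')).eventually_const_lt hξ
  have h2 : Tendsto (fun s : ℝ => x + s • ξ) (𝓝[>] 0) (𝓝 x) := by
    have := hline.continuousAt.tendsto
    simp only [zero_smul, add_zero] at this
    exact this.mono_left nhdsWithin_le_nhds
  filter_upwards [h1, h2.eventually hev, self_mem_nhdsWithin] with s hs1 hs2 hs3
  refine hs2.2 ?_
  have hs3 : (0 : ℝ) < s := hs3
  simp only [slope_def_field, zero_smul, add_zero, sub_zero, h0] at hs1
  exact (div_pos_iff_of_pos_right hs3).1 hs1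

theorem IsInnerUnitNormal.norm_eq_one {ν : 𝔼} (h : IsInnerUnitNormal Ω x ν) : ‖ν‖ = 1 := by
  obtain ⟨ρ, ⟨-, h0, -⟩, rfl⟩ := h
  rw [norm_smul, norm_inv, norm_norm, inv_mul_cancel₀ (norm_ne_zero_iff.2 h0)]

theorem IsInnerUnitNormal.eventually_mem (hΩ : IsOpen Ω) (hx : x ∈ frontier Ω) {ν : 𝔼}
    (h : IsInnerUnitNormal Ω x ν) {ξ : 𝔼} (hξ : 0 < inner ℝ ν ξ) :
    ∀ᶠ s in 𝓝[>] (0 : ℝ), x + s • ξ ∈ Ω := by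
  obtain ⟨ρ, hρ, rfl⟩ := h
  refine hρ.eventually_mem hΩ hx ?_
  rw [real_inner_smul_left] at hξ
  exact (pos_iff_pos_of_mul_pos hξ).1 (inv_pos.2 (norm_pos_iff.2 hρ.2.1))

/-- The normal may come from a different defining function than $\rho$. Rays with
$\langle\nu,\xi\rangle>0$ enter $\Omega$, where $\rho>0=\rho(x)$, so $D\rho(x)$ is nonnegative on
that half space and is a multiple of $\langle\nu,\cdot\rangle$. -/
theorem IsLocalDefiningFunction.gradient_eq (hΩ : IsOpen Ω) (hx : x ∈ frontier Ω) {ν : 𝔼}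
    (h : IsLocalDefiningFunction Ω x ρ) (hν : IsInnerUnitNormal Ω x ν) :
    gradient ρ x = ‖gradient ρ x‖ • ν := by
  have hl : ∀ ξ, 0 < inner ℝ ν ξ → 0 ≤ fderiv ℝ ρ x ξ := by
    intro ξ hξ
    by_contra! hneg
    have h1 := hν.eventually_mem hΩ hx hξ
    have hρ0 := h.eq_zero hΩ hx
    obtain ⟨hsm, -, hev⟩ := h
    have hline : HasDerivAt (fun s : ℝ => x + s • ξ) ξ 0 := by
      simpa using ((hasDerivAt_id (0 : ℝ)).smul_const ξ).const_add x
    have hd : HasDerivAt (fun s : ℝ => ρ (x + s • ξ)) (fderiv ℝ ρ x ξ) 0 := by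
      have h1 : HasFDerivAt ρ (fderiv ℝ ρ x) (x + (0 : ℝ) • ξ) := by
        simpa using (hsm.differentiable (by simp)).differentiableAt.hasFDerivAt
      exact h1.comp_hasDerivAt (0 : ℝ) hline
    have h2 : Tendsto (fun s : ℝ => x + s • ξ) (𝓝[>] 0) (𝓝 x) := by
      have := hline.continuousAt.tendsto
      simp only [zero_smul, add_zero] at this
      exact this.mono_left nhdsWithin_le_nhds
    have h3 := hd.hasDerivWithinAt (s := Ioi 0) |>.le_of_eventually_le
      (hasDerivWithinAt_const (0 : ℝ) (Ioi 0) (0 : ℝ)) (by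
        filter_upwards [h1, h2.eventually hev] with s hs1 hs2
        simpa [hρ0] using (hs2.1 hs1).le)
    linarith
  have hν1 := hν.norm_eq_one
  have heq : gradient ρ x = (fderiv ℝ ρ x ν) • ν := by
    refine ext_inner_right ℝ fun ξ => ?_
    rw [inner_gradient_eq_fderiv, real_inner_smul_left, apply_eq_mul_inner_of_nonneg hν1 hl ξ]
  have hpos : 0 ≤ fderiv ℝ ρ x ν := hl ν (by rw [real_inner_self_eq_norm_sq, hν1]; norm_num)
  have hnorm : ‖gradient ρ x‖ = fderiv ℝ ρ x ν := by
    rw [heq, norm_smul, hν1, mul_one, Real.norm_of_nonneg hpos]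
  rw [hnorm]; exact heq

/-- A uniform interior sphere condition near a boundary point with a smooth local defining
function. -/
theorem IsLocalDefiningFunction.exists_interior_ball (hΩ : IsOpen Ω)
    (h : IsLocalDefiningFunction Ω x ρ) :
    ∃ r > 0, ∀ᶠ y in 𝓝 x, y ∈ frontier Ω → ∀ ν, IsInnerUnitNormal Ω y ν →
      ball (y + r • ν) r ⊆ Ω := by
  obtain ⟨hsm, hne, hev⟩ := h
  have hC1 : ContDiff ℝ 1 (fderiv ℝ ρ) := hsm.fderiv_right (by norm_num; exact ENat.LEInfty.out)
  obtain ⟨M, S, hS, hLip⟩ := hC1.contDiffAt (x := x) |>.exists_lipschitzOnWith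
  set g := ‖gradient ρ x‖ / 2 with hg
  have hgpos : 0 < g := half_pos (norm_pos_iff.2 hne)
  have hgc : Continuous (gradient ρ) := by
    unfold gradient
    exact (LinearIsometryEquiv.continuous _).comp hC1.continuous
  have hgn : ∀ᶠ y in 𝓝 x, g < ‖gradient ρ y‖ :=
    hgc.norm.continuousAt.eventually_const_lt (half_lt_self (norm_pos_iff.2 hne))
  obtain ⟨d, hd, hdS⟩ := Metric.mem_nhds_iff.1 (inter_mem hS (inter_mem hev hgn))
  -- The first condition keeps the ball inside the neighbourhood where the Lipschitz and gradient
  -- bounds hold; the second lets the linear term of $\rho$ dominate the Taylor error.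
  obtain ⟨r, hr, hrd, hrM⟩ : ∃ r > 0, 2 * r ≤ d / 2 ∧ 2 * r * M < g := by
    refine ⟨min (d / 4) (g / (4 * (M + 1))), by positivity, ?_, ?_⟩
    · have := min_le_left (d / 4) (g / (4 * (M + 1)))
      linarith
    · have h1 := min_le_right (d / 4) (g / (4 * ((M : ℝ) + 1)))
      have h2 : g / (4 * ((M : ℝ) + 1)) * (4 * (M + 1)) = g := by
        field_simp
      have hM : (0 : ℝ) ≤ M := M.2
      have h3 : 0 < min (d / 4) (g / (4 * ((M : ℝ) + 1))) := by positivity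
      nlinarith
  refine ⟨r, hr, ?_⟩
  filter_upwards [ball_mem_nhds x (half_pos hd)] with y hy hyf ν hν w hw
  have hyd : y ∈ ball x d := ball_subset_ball (by linarith) hy
  have hyloc : IsLocalDefiningFunction Ω y ρ := by
    refine ⟨hsm, norm_pos_iff.1 (hgpos.trans (hdS hyd).2.2), ?_⟩
    filter_upwards [isOpen_ball.mem_nhds hyd] with w hw using (hdS hw).2.1
  have hν1 := hν.norm_eq_one
  have hwy : ‖w - y‖ < 2 * r := by
    have h1 : ‖w - (y + r • ν)‖ < r := by simpa [dist_eq_norm] using hw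
    calc ‖w - y‖ = ‖(w - (y + r • ν)) + r • ν‖ := by congr 1; abel
      _ ≤ ‖w - (y + r • ν)‖ + ‖r • ν‖ := norm_add_le _ _
      _ < r + r := by
          rw [norm_smul, hν1, mul_one, Real.norm_of_nonneg hr.le]; linarith
      _ = 2 * r := by ring
  have hsub : closedBall y ‖w - y‖ ⊆ ball x d := by
    intro z hz
    have h1 : dist z y ≤ ‖w - y‖ := hz
    have h2 : dist y x < d / 2 := hy
    have := dist_triangle z y x
    rw [mem_ball]; linarith
  have hwd : w ∈ closedBall y ‖w - y‖ := by simp [dist_eq_norm]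
  -- In a ball tangent at $y$ the squared distance to $y$ is controlled by the normal component, so
  -- the quadratic error is at most $2rM\langle\nu,w-y\rangle$.
  have hsq : ‖w - y‖ ^ 2 < 2 * r * inner ℝ ν (w - y) := by
    have h1 : ‖(w - y) - r • ν‖ < r := by
      rw [sub_sub]; simpa [dist_eq_norm] using hw
    have h2 : ‖(w - y) - r • ν‖ ^ 2 < r ^ 2 := by gcongr
    rw [norm_sub_sq_real, real_inner_smul_right, norm_smul, hν1, mul_one,
      Real.norm_of_nonneg hr.le, real_inner_comm] at h2
    linarith
  have htaylor : ‖ρ w - ρ y - fderiv ℝ ρ y (w - y)‖ ≤ (M * ‖w - y‖) * ‖w - y‖ := by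
    refine (convex_closedBall y ‖w - y‖).norm_image_sub_le_of_norm_fderiv_le'
      (fun z _ => (hsm.differentiable (by simp)).differentiableAt) (fun z hz => ?_)
      (mem_closedBall_self (norm_nonneg _)) hwd
    have := hLip.dist_le_mul z (hdS (hsub hz)).1 y (hdS hyd).1
    rw [dist_eq_norm] at this
    refine this.trans ?_
    have : dist z y ≤ ‖w - y‖ := hz
    gcongr
  rw [hyloc.eq_zero hΩ hyf, sub_zero, ← inner_gradient_eq_fderiv,
    hyloc.gradient_eq hΩ hyf hν, real_inner_smul_left, Real.norm_eq_abs] at htaylor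
  have h1 := (abs_le.1 htaylor).1
  refine (hdS (hsub hwd)).2.1.2 ?_
  have h2 : g < ‖gradient ρ y‖ := (hdS hyd).2.2
  have hM : (0 : ℝ) ≤ M := M.2
  set t : ℝ := inner ℝ ν (w - y)
  have ht : 0 < t := by
    by_contra! ht
    nlinarith [sq_nonneg ‖w - y‖]
  have h3 : (M : ℝ) * ‖w - y‖ * ‖w - y‖ ≤ 2 * r * M * t := by nlinarith
  have h4 : 2 * r * M * t < ‖gradient ρ y‖ * t := by
    apply mul_lt_mul_of_pos_right _ ht; linarith
  linarith

/-- Balls tangent at the same point are nested, so the local radii can be merged by taking minima in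
the compactness argument. -/
theorem ball_add_smul_subset {x ν : 𝔼} (hν : ‖ν‖ = 1) {r s : ℝ} (hrs : r ≤ s) :
    ball (x + r • ν) r ⊆ ball (x + s • ν) s := by
  refine ball_subset_ball' ?_
  rw [dist_eq_norm, add_sub_add_left_eq_sub, ← sub_smul, norm_smul, hν, Real.norm_eq_abs,
    abs_of_nonpos (by linarith)]
  linarith

/-- A bounded uniformly convex domain satisfies a uniform interior sphere condition. -/
theorem IsUniformlyConvexDomain.exists_interior_ball (hΩ : IsUniformlyConvexDomain Ω) :
    ∃ r > 0, ∀ y ∈ frontier Ω, ∀ ν, IsInnerUnitNormal Ω y ν → ball (y + r • ν) r ⊆ Ω := by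
  have hcomp : IsCompact (frontier Ω) :=
    hΩ.isBounded.isCompact_closure.of_isClosed_subset isClosed_frontier frontier_subset_closure
  have := hcomp.induction_on
    (p := fun S => ∃ r > 0, ∀ y ∈ S, y ∈ frontier Ω → ∀ ν, IsInnerUnitNormal Ω y ν →
      ball (y + r • ν) r ⊆ Ω) ⟨1, one_pos, by simp⟩
    (fun S T hST ⟨r, hr, h⟩ => ⟨r, hr, fun y hy => h y (hST hy)⟩)
    (fun S T ⟨r, hr, h⟩ ⟨s, hs, h'⟩ => ⟨min r s, lt_min hr hs, fun y hy hyf ν hν => by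
      rcases hy with hy | hy
      · exact (ball_add_smul_subset hν.norm_eq_one (min_le_left _ _)).trans (h y hy hyf ν hν)
      · exact (ball_add_smul_subset hν.norm_eq_one (min_le_right _ _)).trans (h' y hy hyf ν hν)⟩)
    (fun y hy => by
      obtain ⟨κ, -, hκ⟩ := hΩ.curvature
      obtain ⟨ρ, hρ, -⟩ := hκ y hy
      obtain ⟨r, hr, h⟩ := hρ.exists_interior_ball hΩ.isOpen
      exact ⟨_, mem_nhdsWithin_of_mem_nhds h, r, hr, fun z hz => hz⟩)
  obtain ⟨r, hr, h⟩ := this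
  exact ⟨r, hr, fun y hy => h y hy hy⟩

end Normal

/-! ### Interior estimates and the algebra of the barrier -/

section Interior

variable {n : ℕ}

local notation "𝔼" => EuclideanSpace ℝ (Fin n)

/-- The Hessian as a bilinear form. -/
noncomputable def hessian (u : 𝔼 → ℝ) (y : 𝔼) : 𝔼 →L[ℝ] 𝔼 →L[ℝ] ℝ :=
  fderiv ℝ (fderiv ℝ u) y

/-- `u` is a `C²` function with nonnegative Hessian on the open set `Ω`, uniformly spacelike,
whose graph has constant mean curvature `c`; the equation is written in polynomial form. -/
structure IsConvexCMC (Ω : Set 𝔼) (δ c : ℝ) (u : 𝔼 → ℝ) : Prop where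
  isOpen : IsOpen Ω
  contDiffOn : ContDiffOn ℝ 2 u Ω
  hessian_nonneg : ∀ y ∈ Ω, ∀ ξ, 0 ≤ hessian u y ξ ξ
  pos : 0 < δ
  le_one_sub : ∀ y ∈ Ω, δ ≤ 1 - ‖gradient u y‖ ^ 2
  equation : ∀ y ∈ Ω, (1 - ‖gradient u y‖ ^ 2) * bilinTrace (hessian u y) +
    hessian u y (gradient u y) (gradient u y) = c * √(1 - ‖gradient u y‖ ^ 2) ^ 3

namespace IsConvexCMC

variable {Ω : Set (EuclideanSpace ℝ (Fin n))} {δ c : ℝ} {u : EuclideanSpace ℝ (Fin n) → ℝ}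
  {y : EuclideanSpace ℝ (Fin n)}

theorem contDiffAt (h : IsConvexCMC Ω δ c u) (hy : y ∈ Ω) : ContDiffAt ℝ 2 u y :=
  h.contDiffOn.contDiffAt (h.isOpen.mem_nhds hy)

theorem hasFDerivAt (h : IsConvexCMC Ω δ c u) (hy : y ∈ Ω) :
    HasFDerivAt u (fderiv ℝ u y) y :=
  ((h.contDiffAt hy).differentiableAt (by norm_num)).hasFDerivAt

theorem hasFDerivAt_fderiv (h : IsConvexCMC Ω δ c u) (hy : y ∈ Ω) :
    HasFDerivAt (fderiv ℝ u) (hessian u y) y :=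
  (((h.contDiffAt hy).fderiv_right (m := 1) (by norm_num)).differentiableAt
    (by norm_num)).hasFDerivAt

theorem symm (h : IsConvexCMC Ω δ c u) (hy : y ∈ Ω) (ξ η : 𝔼) :
    hessian u y ξ η = hessian u y η ξ :=
  ((h.contDiffAt hy).isSymmSndFDerivAt (by simp)).eq ξ η

theorem hasDerivAt_line (h : IsConvexCMC Ω δ c u) {ξ : 𝔼} {s : ℝ} (hy : y + s • ξ ∈ Ω) :
    HasDerivAt (fun s : ℝ => u (y + s • ξ)) (fderiv ℝ u (y + s • ξ) ξ) s := by
  have hline : HasDerivAt (fun s : ℝ => y + s • ξ) ξ s := by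
    simpa using ((hasDerivAt_id s).smul_const ξ).const_add y
  exact (h.hasFDerivAt hy).comp_hasDerivAt s hline

theorem hasFDerivAt_fderiv_apply (h : IsConvexCMC Ω δ c u) (hy : y ∈ Ω) (η : 𝔼) :
    HasFDerivAt (fun z => fderiv ℝ u z η) ((hessian u y).flip η) y := by
  have := (h.hasFDerivAt_fderiv hy).clm_apply (hasFDerivAt_const η y)
  simpa using this

theorem hasDerivAt_fderiv_line (h : IsConvexCMC Ω δ c u) {ξ η : 𝔼} {s : ℝ}
    (hy : y + s • ξ ∈ Ω) :
    HasDerivAt (fun s : ℝ => fderiv ℝ u (y + s • ξ) η) (hessian u (y + s • ξ) ξ η) s := by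
  have hline : HasDerivAt (fun s : ℝ => y + s • ξ) ξ s := by
    simpa using ((hasDerivAt_id s).smul_const ξ).const_add y
  exact (h.hasFDerivAt_fderiv_apply hy η).comp_hasDerivAt s hline

theorem eventually_mem_line (h : IsConvexCMC Ω δ c u) (hy : y ∈ Ω) (ξ : 𝔼) :
    ∀ᶠ s in 𝓝 (0 : ℝ), y + s • ξ ∈ Ω := by
  have : ContinuousAt (fun s : ℝ => y + s • ξ) 0 := by fun_prop
  exact this.eventually_mem (h.isOpen.mem_nhds (by simpa using hy))

theorem norm_gradient_le_one (h : IsConvexCMC Ω δ c u) (hy : y ∈ Ω) : ‖gradient u y‖ ≤ 1 := by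
  have := h.le_one_sub y hy
  have := h.pos
  nlinarith [norm_nonneg (gradient u y)]

theorem nonneg (h : IsConvexCMC Ω δ c u) (hy : y ∈ Ω) : 0 ≤ c := by
  have h1 := h.equation y hy
  have h2 := h.le_one_sub y hy
  have h3 := bilinTrace_nonneg (h.hessian_nonneg y hy)
  have h4 := h.hessian_nonneg y hy (gradient u y)
  have hX : 0 < 1 - ‖gradient u y‖ ^ 2 := h.pos.trans_le h2
  have h5 : 0 < √(1 - ‖gradient u y‖ ^ 2) ^ 3 := by positivity
  by_contra! hc
  nlinarith [mul_nonneg hX.le h3, mul_pos (neg_pos.2 hc) h5]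

/-- Dropping the nonnegative term $D^2u(Du,Du)$ leaves $X\,\mathrm{tr}\,D^2u\le cX^{3/2}$ with
$X=1-|Du|^2\in(0,1]$. -/
theorem bilinTrace_le (h : IsConvexCMC Ω δ c u) (hy : y ∈ Ω) :
    bilinTrace (hessian u y) ≤ c := by
  have h1 := h.equation y hy
  have h2 := h.le_one_sub y hy
  have h4 := h.hessian_nonneg y hy (gradient u y)
  have hc := h.nonneg hy
  set X := 1 - ‖gradient u y‖ ^ 2 with hXdef
  have hX : 0 < X := h.pos.trans_le h2
  have hX1 : √X ≤ 1 := Real.sqrt_le_one.2 (by rw [hXdef]; nlinarith [norm_nonneg (gradient u y)])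
  have hcube : √X ^ 3 = X * √X := by
    rw [pow_succ, Real.sq_sqrt hX.le]
  rw [hcube] at h1
  have h5 : X * bilinTrace (hessian u y) ≤ X * c := by
    have : c * (X * √X) ≤ X * c := by nlinarith [mul_nonneg hc hX.le]
    linarith
  exact le_of_mul_le_mul_left h5 hX

theorem abs_hessian_le (h : IsConvexCMC Ω δ c u) (hy : y ∈ Ω) (ξ η : 𝔼) :
    |hessian u y ξ η| ≤ c * ‖ξ‖ * ‖η‖ := by
  refine (abs_apply_le_bilinTrace_mul (h.symm hy) (h.hessian_nonneg y hy) ξ η).trans ?_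
  have := h.bilinTrace_le hy
  gcongr

theorem abs_fderiv_sub_le (h : IsConvexCMC Ω δ c u) (hconv : Convex ℝ Ω) {x y e : 𝔼}
    (hx : x ∈ Ω) (hy : y ∈ Ω) (he : ‖e‖ = 1) :
    |fderiv ℝ u y e - fderiv ℝ u x e| ≤ c * ‖y - x‖ := by
  rw [← Real.norm_eq_abs]
  refine hconv.norm_image_sub_le_of_norm_hasFDerivWithin_le
    (f := fun z => fderiv ℝ u z e) (f' := fun z => (hessian u z).flip e) (fun z hz => ?_)
    (fun z hz => ?_) hx hy
  · exact (h.hasFDerivAt_fderiv_apply hz e).hasFDerivWithinAt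
  · refine ContinuousLinearMap.opNorm_le_bound _ (h.nonneg hz) fun ξ => ?_
    simpa [he] using h.abs_hessian_le hz ξ e

/-- If `u` is touched from above by a paraboloid of opening `K`, then `c` is controlled. -/
theorem mul_sqrt_le_of_isLocalMax (h : IsConvexCMC Ω δ c u) (hy : y ∈ Ω) {z : 𝔼} {K : ℝ}
    (hK : 0 ≤ K) (hmax : IsLocalMax (fun w => u w - K * ‖w - z‖ ^ 2) y) :
    c * √δ ^ 3 ≤ 2 * K * (n + 1) := by
  have hH : ∀ ξ, hessian u y ξ ξ ≤ 2 * K * ‖ξ‖ ^ 2 := by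
    intro ξ
    have hmin : IsLocalMin (fun s : ℝ => -(u (y + s • ξ)) + K * ‖y + s • ξ - z‖ ^ 2) 0 := by
      have hc : ContinuousAt (fun s : ℝ => y + s • ξ) 0 := by fun_prop
      have hc' : Tendsto (fun s : ℝ => y + s • ξ) (𝓝 0) (𝓝 y) := by simpa using hc.tendsto
      filter_upwards [hc'.eventually hmax] with s hs
      simp only [zero_smul, add_zero]
      linarith
    have hline : ∀ s : ℝ, HasDerivAt (fun s : ℝ => y + s • ξ - z) ξ s := fun s => by
      simpa using (((hasDerivAt_id s).smul_const ξ).const_add y).sub_const z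
    have := (hmin.deriv_eq_zero_and_snd_deriv_nonneg
      (g' := fun s => -(fderiv ℝ u (y + s • ξ) ξ) + K * (2 * inner ℝ (y + s • ξ - z) ξ))
      (k := -(hessian u (y + (0 : ℝ) • ξ) ξ ξ) + K * (2 * inner ℝ ξ ξ)) (by
        filter_upwards [h.eventually_mem_line hy ξ] with s hs
        exact (h.hasDerivAt_line hs).neg.add ((hline s).norm_sq.const_mul K))
      (by
        refine (h.hasDerivAt_fderiv_line (by simpa using hy)).neg.add ?_
        refine HasDerivAt.const_mul K (HasDerivAt.const_mul 2 ?_)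
        simpa using (hline 0).inner ℝ (hasDerivAt_const 0 ξ))).2
    rw [real_inner_self_eq_norm_sq] at this
    simp only [zero_smul, add_zero] at this
    linarith
  have hT : bilinTrace (hessian u y) ≤ 2 * K * n := by
    calc bilinTrace (hessian u y) ≤ ∑ _i : Fin n, 2 * K :=
          Finset.sum_le_sum fun i _ => by simpa using hH (EuclideanSpace.single i 1)
      _ = 2 * K * n := by simp; ring
  have h1 := h.equation y hy
  have h2 := h.le_one_sub y hy
  have hpos := h.pos
  have h3 := hH (gradient u y)
  have h5 := h.norm_gradient_le_one hy
  have h6 : ‖gradient u y‖ ^ 2 ≤ 1 := by nlinarith [norm_nonneg (gradient u y)]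
  have h7 : √δ ^ 3 ≤ √(1 - ‖gradient u y‖ ^ 2) ^ 3 := by gcongr
  have h8 := mul_le_mul_of_nonneg_left h7 (h.nonneg hy)
  have h9 := bilinTrace_nonneg (h.hessian_nonneg y hy)
  have h10 : (1 - ‖gradient u y‖ ^ 2) * bilinTrace (hessian u y) ≤ bilinTrace (hessian u y) := by
    nlinarith [sq_nonneg ‖gradient u y‖]
  have h11 : 2 * K * ‖gradient u y‖ ^ 2 ≤ 2 * K := by nlinarith
  linarith

/-- As $|Du|\le1$, $u$ gains at most $r$ from the centre to the sphere, while the paraboloid of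
opening $2/r$ rises by $2r$. So the maximum of the difference is interior. -/
theorem mul_sqrt_le (h : IsConvexCMC Ω δ c u) {z : 𝔼} {r : ℝ} (hr : 0 < r)
    (hball : closedBall z r ⊆ Ω) : c * √δ ^ 3 ≤ 4 / r * (n + 1) := by
  have hK : (0 : ℝ) < 2 / r := by positivity
  set f : 𝔼 → ℝ := fun w => u w - 2 / r * ‖w - z‖ ^ 2 with hf
  have hcont : ContinuousOn f (closedBall z r) := by
    have := h.contDiffOn.continuousOn.mono hball
    fun_prop
  obtain ⟨y, hy, hmax⟩ := (isCompact_closedBall z r).exists_isMaxOn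
    ⟨z, mem_closedBall_self hr.le⟩ hcont
  have hy' : y ∈ ball z r := by
    rw [mem_ball]
    refine lt_of_le_of_ne hy fun heq => ?_
    have h1 : f z ≤ f y := hmax (mem_closedBall_self hr.le)
    have hnorm : ‖y - z‖ = r := by rw [← dist_eq_norm, heq]
    have h2 : ‖u y - u z‖ ≤ 1 * ‖y - z‖ := by
      refine (convex_closedBall z r).norm_image_sub_le_of_norm_fderiv_le
        (fun w hw => (h.hasFDerivAt (hball hw)).differentiableAt) (fun w hw => ?_)
        (mem_closedBall_self hr.le) hy
      have := h.norm_gradient_le_one (hball hw)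
      rwa [gradient, LinearIsometryEquiv.norm_map] at this
    rw [hnorm, Real.norm_eq_abs] at h2
    have h3 := (abs_le.1 h2).2
    simp only [hf, sub_self, norm_zero, hnorm] at h1
    have h4 : 2 / r * r ^ 2 = 2 * r := by field_simp
    rw [h4] at h1
    norm_num at h1
    linarith
  have := h.mul_sqrt_le_of_isLocalMax (hball hy) hK.le
    (hmax.isLocalMax (closedBall_mem_nhds_of_mem hy'))
  calc _ ≤ _ := this
    _ = _ := by ring

end IsConvexCMC

theorem sqrt_pow_three_sub_le {X P : ℝ} (hX0 : 0 ≤ X) (hX1 : X ≤ 1) (hP0 : 0 ≤ P) (hP1 : P ≤ 1) :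
    √X ^ 3 - √P ^ 3 ≤ 2 * |X - P| := by
  have ha := Real.sqrt_nonneg X
  have hb := Real.sqrt_nonneg P
  have ha1 : √X ≤ 1 := Real.sqrt_le_one.2 hX1
  have hb1 : √P ≤ 1 := Real.sqrt_le_one.2 hP1
  have ha2 := Real.sq_sqrt hX0
  have hb2 := Real.sq_sqrt hP0
  rcases le_total (√X) (√P) with hab | hab
  · have : √X ^ 3 ≤ √P ^ 3 := by gcongr
    linarith [abs_nonneg (X - P)]
  · have h1 : 2 * (√X ^ 2 - √P ^ 2) - (√X ^ 3 - √P ^ 3) =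
        (√X - √P) * (2 * (√X + √P) - (√X ^ 2 + √X * √P + √P ^ 2)) := by ring
    have h2 : 0 ≤ 2 * (√X + √P) - (√X ^ 2 + √X * √P + √P ^ 2) := by
      have e1 : √X ^ 2 ≤ √X := by rw [sq]; exact mul_le_of_le_one_left ha ha1
      have e2 : √X * √P ≤ √P := mul_le_of_le_one_left hb ha1
      have e3 : √P ^ 2 ≤ √P := by rw [sq]; exact mul_le_of_le_one_left hb hb1
      linarith
    have h3 := mul_nonneg (sub_nonneg.2 hab) h2
    rw [← h1, ha2, hb2] at h3
    linarith [le_abs_self (X - P)]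

/-- The algebraic core of the comparison principle: two solutions of the equation at two points,
whose gradients and Hessians differ by those of a strict exponential barrier, cannot exist. -/
theorem false_of_barrier_touching {B B' : 𝔼 →L[ℝ] 𝔼 →L[ℝ] ℝ} {p q Y : 𝔼}
    {c δ κ α r R : ℝ}
    (hs : ∀ ξ η, B ξ η = B η ξ) (hB : ∀ ξ η, |B ξ η| ≤ c * ‖ξ‖ * ‖η‖)
    (hT0 : 0 ≤ bilinTrace B) (hT : bilinTrace B ≤ c) (hc : 0 ≤ c) (hδ : 0 < δ)
    (hp : δ ≤ 1 - ‖p‖ ^ 2) (hq : δ ≤ 1 - ‖q‖ ^ 2)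
    (hpB : (1 - ‖p‖ ^ 2) * bilinTrace B + B p p = c * √(1 - ‖p‖ ^ 2) ^ 3)
    (hqB : (1 - ‖q‖ ^ 2) * bilinTrace B' + B' q q = c * √(1 - ‖q‖ ^ 2) ^ 3)
    (hκ : 0 < κ) (hα : 0 < α) (hr : 0 < r) (hrY : r ≤ ‖Y‖) (hYR : ‖Y‖ ≤ R)
    (hgrad : q - p = (-(2 * α * κ)) • Y)
    (hhess : ∀ ξ, B ξ ξ + κ * (4 * α ^ 2 * (inner ℝ Y ξ : ℝ) ^ 2 - 2 * α * ‖ξ‖ ^ 2) ≤ B' ξ ξ)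
    (hbar : n + 1 + 8 * c * R < 2 * δ * r ^ 2 * α) : False := by
  -- The two equations are to be subtracted. The barrier adds a gain of order $\kappa\alpha^2\delta
  -- r^2$ to the left side, while all other changes are of order $\kappa\alpha$.
  have hTT : bilinTrace B + κ * (4 * α ^ 2 * ‖Y‖ ^ 2 - 2 * α * n) ≤ bilinTrace B' := by
    have hY : ‖Y‖ ^ 2 = ∑ i, Y i ^ 2 := EuclideanSpace.real_norm_sq_eq Y
    calc _ = ∑ i : Fin n, (B (EuclideanSpace.single i 1) (EuclideanSpace.single i 1)
          + κ * (4 * α ^ 2 * Y i ^ 2 - 2 * α)) := by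
          rw [Finset.sum_add_distrib, ← Finset.mul_sum, Finset.sum_sub_distrib,
            ← Finset.mul_sum, hY, bilinTrace]
          simp only [Finset.sum_const, Finset.card_univ, Fintype.card_fin, nsmul_eq_mul]
          ring
      _ ≤ _ := Finset.sum_le_sum fun i _ => by
          have := hhess (EuclideanSpace.single i 1)
          simpa [EuclideanSpace.inner_single_right] using this
  have hqq := hhess q
  have hpn : ‖p‖ ≤ 1 := by nlinarith [norm_nonneg p]
  have hqn : ‖q‖ ≤ 1 := by nlinarith [norm_nonneg q]
  have hd : ‖q - p‖ ≤ 2 * α * κ * R := by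
    rw [hgrad, norm_smul, norm_neg, Real.norm_of_nonneg (by positivity)]; gcongr
  set D := ‖q - p‖ with hD
  have hD0 : 0 ≤ D := norm_nonneg _
  have hnn : |‖q‖ - ‖p‖| ≤ D := abs_norm_sub_norm_le q p
  set X := 1 - ‖q‖ ^ 2 with hX
  set P := 1 - ‖p‖ ^ 2 with hP
  have hX1 : X ≤ 1 := by rw [hX]; nlinarith [norm_nonneg q]
  have hP1 : P ≤ 1 := by rw [hP]; nlinarith [norm_nonneg p]
  have hX0 : 0 < X := hδ.trans_le hq
  have hP0 : 0 < P := hδ.trans_le hp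
  have hXP : |X - P| ≤ 2 * D := by
    have : X - P = -((‖q‖ - ‖p‖) * (‖q‖ + ‖p‖)) := by rw [hX, hP]; ring
    rw [this, abs_neg, abs_mul, abs_of_nonneg (a := ‖q‖ + ‖p‖) (by positivity)]
    calc |‖q‖ - ‖p‖| * (‖q‖ + ‖p‖) ≤ D * 2 := by gcongr; linarith
      _ = 2 * D := mul_comm _ _
  have hcube : √X ^ 3 - √P ^ 3 ≤ 4 * D := by
    have := sqrt_pow_three_sub_le hX0.le hX1 hP0.le hP1
    linarith
  have hBB : B p p - B q q ≤ 2 * c * D := by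
    have : B p p - B q q = -B (q - p) (q + p) := by
      simp only [map_sub, map_add, sub_apply]
      rw [hs p q]; ring
    rw [this]
    refine (neg_le_abs _).trans ((hB _ _).trans ?_)
    have : ‖q + p‖ ≤ 2 := (norm_add_le _ _).trans (by linarith)
    calc c * D * ‖q + p‖ ≤ c * D * 2 := by gcongr
      _ = 2 * c * D := by ring
  have hdT : (P - X) * bilinTrace B ≤ 2 * c * D := by
    have h1 : (P - X) * bilinTrace B ≤ (2 * D) * bilinTrace B := by
      have := (abs_le.1 hXP).1
      exact mul_le_mul_of_nonneg_right (by linarith) hT0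
    have h2 : (2 * D) * bilinTrace B ≤ (2 * D) * c := by gcongr
    linarith
  have h1 : X * (bilinTrace B + κ * (4 * α ^ 2 * ‖Y‖ ^ 2 - 2 * α * n)) ≤ X * bilinTrace B' := by
    gcongr
  have h2 : c * (√X ^ 3 - √P ^ 3) ≤ c * (4 * D) := by gcongr
  have h3 : κ * (4 * δ * α ^ 2 * r ^ 2 - 2 * α * (n + 1)) ≤
      X * (κ * (4 * α ^ 2 * ‖Y‖ ^ 2 - 2 * α * n)) +
      κ * (4 * α ^ 2 * (inner ℝ Y q : ℝ) ^ 2 - 2 * α * ‖q‖ ^ 2) := by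
    have e1 : δ * r ^ 2 ≤ X * ‖Y‖ ^ 2 := by gcongr
    have e2 : X * n ≤ n := mul_le_of_le_one_left (Nat.cast_nonneg n) hX1
    have e3 : ‖q‖ ^ 2 ≤ 1 := by nlinarith [norm_nonneg q]
    have e4 : 4 * α ^ 2 * (δ * r ^ 2) ≤ 4 * α ^ 2 * (X * ‖Y‖ ^ 2) := by gcongr
    have e5 : 2 * α * (X * n) ≤ 2 * α * n := by gcongr
    have e6 : 2 * α * ‖q‖ ^ 2 ≤ 2 * α * 1 := by gcongr
    have e7 : 0 ≤ 4 * α ^ 2 * (inner ℝ Y q : ℝ) ^ 2 := by positivity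
    rw [mul_left_comm X κ, ← mul_add]
    refine mul_le_mul_of_nonneg_left ?_ hκ.le
    linarith
  -- The constant 8 collects $2cD$ from the coefficient of the trace, $2cD$ from the quadratic term
  -- and $4cD$ from the right-hand side.
  have h4 : κ * (4 * δ * α ^ 2 * r ^ 2 - 2 * α * (n + 1)) ≤ 8 * c * D := by linarith
  have h5 : 8 * c * D ≤ 8 * c * (2 * α * κ * R) := by gcongr
  have h6 : 0 < (2 * α * κ) * (2 * δ * r ^ 2 * α - (n + 1 + 8 * c * R)) :=
    mul_pos (by positivity) (by linarith)
  linarith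

end Interior

/-! ### Exponential barriers and propagation of positivity -/

section Comparison

variable {n : ℕ}

local notation "𝔼" => EuclideanSpace ℝ (Fin n)

theorem hasDerivAt_exp_line (α : ℝ) (Y ξ : 𝔼) (s : ℝ) :
    HasDerivAt (fun s : ℝ => Real.exp (-α * ‖Y + s • ξ‖ ^ 2))
      (Real.exp (-α * ‖Y + s • ξ‖ ^ 2) * (-α * (2 * inner ℝ (Y + s • ξ) ξ))) s := by
  have hline : HasDerivAt (fun s : ℝ => Y + s • ξ) ξ s := by
    simpa using ((hasDerivAt_id s).smul_const ξ).const_add Y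
  exact (hline.norm_sq.const_mul (-α)).exp

theorem hasDerivAt_exp_line_deriv (α : ℝ) (Y ξ : 𝔼) :
    HasDerivAt
      (fun s : ℝ => Real.exp (-α * ‖Y + s • ξ‖ ^ 2) * (-α * (2 * inner ℝ (Y + s • ξ) ξ)))
      (Real.exp (-α * ‖Y‖ ^ 2) * (4 * α ^ 2 * (inner ℝ Y ξ : ℝ) ^ 2 - 2 * α * ‖ξ‖ ^ 2)) 0 := by
  have hline : HasDerivAt (fun s : ℝ => Y + s • ξ) ξ 0 := by
    simpa using ((hasDerivAt_id (0 : ℝ)).smul_const ξ).const_add Y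
  have h1 : HasDerivAt (fun s : ℝ => inner ℝ (Y + s • ξ) ξ) (inner ℝ ξ ξ) 0 := by
    simpa using hline.inner ℝ (hasDerivAt_const 0 ξ)
  have := (hasDerivAt_exp_line α Y ξ 0).mul ((h1.const_mul 2).const_mul (-α))
  refine this.congr_deriv ?_
  simp only [zero_smul, add_zero, real_inner_self_eq_norm_sq]
  ring

namespace IsConvexCMC

variable {Ω : Set (EuclideanSpace ℝ (Fin n))} {δ c : ℝ} {u : EuclideanSpace ℝ (Fin n) → ℝ}

theorem mul_le_sub (h : IsConvexCMC Ω δ c u) {y e : 𝔼} {t b : ℝ} (ht : 0 ≤ t)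
    (hseg : ∀ s ∈ Icc 0 t, y + s • e ∈ Ω) (hb : ∀ s ∈ Icc 0 t, b ≤ fderiv ℝ u (y + s • e) e) :
    t * b ≤ u (y + t • e) - u y := by
  have hd : ∀ s ∈ Icc 0 t, HasDerivAt (fun s : ℝ => u (y + s • e)) (fderiv ℝ u (y + s • e) e) s :=
    fun s hs => h.hasDerivAt_line (hseg s hs)
  have := (convex_Icc 0 t).mul_sub_le_image_sub_of_le_deriv (f := fun s : ℝ => u (y + s • e))
    (fun s hs => (hd s hs).continuousAt.continuousWithinAt)
    (fun s hs => (hd s (interior_subset hs)).differentiableAt.differentiableWithinAt) (C := b)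
    (fun s hs => by rw [(hd s (interior_subset hs)).deriv]; exact hb s (interior_subset hs))
    0 (left_mem_Icc.2 ht) t (right_mem_Icc.2 ht) ht
  simp only [zero_smul, add_zero, sub_zero] at this
  linarith

/-- The difference of a translate of the solution and the solution cannot be touched from below
by a strict exponential barrier. -/
theorem not_isLocalMin_sub_exp (h : IsConvexCMC Ω δ c u) {y τ z : 𝔼} {r R κ α : ℝ} (hr : 0 < r)
    (hκ : 0 < κ) (hα : 0 < α) (hy : y ∈ Ω) (hyτ : y + τ ∈ Ω) (hry : r ≤ ‖y - z‖)
    (hyR : ‖y - z‖ ≤ R) (hbar : n + 1 + 8 * c * R < 2 * δ * r ^ 2 * α) :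
    ¬ IsLocalMin (fun w => u (w + τ) - u w - κ * Real.exp (-α * ‖w - z‖ ^ 2)) y := by
  intro hmin
  set Y := y - z with hY
  set E := Real.exp (-α * ‖Y‖ ^ 2) with hE
  -- First and second order conditions on every line through $y$ compare the gradients and Hessians
  -- of $u$ at $y$ and $y+\tau$.
  have key : ∀ ξ : 𝔼, fderiv ℝ u (y + τ) ξ - fderiv ℝ u y ξ
      - κ * (E * (-α * (2 * inner ℝ Y ξ))) = 0 ∧
      0 ≤ hessian u (y + τ) ξ ξ - hessian u y ξ ξ
        - κ * (E * (4 * α ^ 2 * (inner ℝ Y ξ : ℝ) ^ 2 - 2 * α * ‖ξ‖ ^ 2)) := by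
    intro ξ
    have hmin' : IsLocalMin (fun s : ℝ => u (y + τ + s • ξ) - u (y + s • ξ)
        - κ * Real.exp (-α * ‖Y + s • ξ‖ ^ 2)) 0 := by
      have hc : ContinuousAt (fun s : ℝ => y + s • ξ) 0 := by fun_prop
      have hc' : Tendsto (fun s : ℝ => y + s • ξ) (𝓝 0) (𝓝 y) := by simpa using hc.tendsto
      filter_upwards [hc'.eventually hmin] with s hs
      have e1 : y + τ + s • ξ = y + s • ξ + τ := by abel
      have e2 : Y + s • ξ = y + s • ξ - z := by rw [hY]; abel
      simpa only [e1, e2, zero_smul, add_zero] using hs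
    have := hmin'.deriv_eq_zero_and_snd_deriv_nonneg
      (g' := fun s => fderiv ℝ u (y + τ + s • ξ) ξ - fderiv ℝ u (y + s • ξ) ξ
        - κ * (Real.exp (-α * ‖Y + s • ξ‖ ^ 2) * (-α * (2 * inner ℝ (Y + s • ξ) ξ))))
      (k := hessian u (y + τ + (0 : ℝ) • ξ) ξ ξ - hessian u (y + (0 : ℝ) • ξ) ξ ξ
        - κ * (E * (4 * α ^ 2 * (inner ℝ Y ξ : ℝ) ^ 2 - 2 * α * ‖ξ‖ ^ 2))) (by
        filter_upwards [h.eventually_mem_line hy ξ, h.eventually_mem_line hyτ ξ] with s hs hs'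
        exact ((h.hasDerivAt_line hs').sub (h.hasDerivAt_line hs)).sub
          ((hasDerivAt_exp_line α Y ξ s).const_mul κ))
      (((h.hasDerivAt_fderiv_line (by simpa using hyτ)).sub
        (h.hasDerivAt_fderiv_line (by simpa using hy))).sub
        ((hasDerivAt_exp_line_deriv α Y ξ).const_mul κ))
    simpa only [zero_smul, add_zero, ← hE] using this
  refine false_of_barrier_touching (h.symm hy) (h.abs_hessian_le hy)
    (bilinTrace_nonneg (h.hessian_nonneg y hy)) (h.bilinTrace_le hy) (h.nonneg hy) h.pos
    (h.le_one_sub y hy) (h.le_one_sub _ hyτ) (h.equation y hy) (h.equation _ hyτ)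
    -- The exponential at the touching point is absorbed into $\kappa$, whose size does not enter
    -- `hbar`.
    (κ := κ * E) (α := α) (by positivity) hα hr hry hyR ?_ (fun ξ => ?_) hbar
  · refine ext_inner_right ℝ fun ξ => ?_
    rw [inner_sub_left, inner_gradient_eq_fderiv, inner_gradient_eq_fderiv, real_inner_smul_left]
    linarith [(key ξ).1]
  · linarith [(key ξ).2]

/-- Comparison of a directional derivative with the exponential barrier on an annulus. -/
theorem barrier_le_fderiv (h : IsConvexCMC Ω δ c u) {e z : 𝔼} {a r R m α : ℝ} (he : ‖e‖ = 1)
    (hv : ∀ y ∈ Ω, a ≤ fderiv ℝ u y e) (hr : 0 < r) (hm : 0 < m) (hα : 0 < α)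
    (hball : closedBall z R ⊆ Ω)
    (hmr : ∀ y ∈ closedBall z (2 * r), y ∈ Ω → a + m ≤ fderiv ℝ u y e)
    (hbar : n + 1 + 8 * c * R < 2 * δ * r ^ 2 * α) {y : 𝔼} (hy : y ∈ closedBall z R)
    (hry : r ≤ ‖y - z‖) :
    a + m * (Real.exp (-α * ‖y - z‖ ^ 2) - Real.exp (-α * R ^ 2)) ≤ fderiv ℝ u y e := by
  -- Room for translating the closed ball by $te$ inside $\Omega$.
  obtain ⟨ε, hε, hεΩ⟩ := (isCompact_closedBall z R).exists_cthickening_subset_open h.isOpen hball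
  have hseg : ∀ t, t ≤ ε → ∀ w ∈ closedBall z R, ∀ s ∈ Icc 0 t, w + s • e ∈ Ω := by
    intro t ht w hw s hs
    refine hεΩ (mem_cthickening_of_dist_le _ w _ _ hw ?_)
    rw [dist_eq_norm, add_sub_cancel_left, norm_smul, he, Real.norm_of_nonneg hs.1]
    linarith [hs.2]
  have hinc : ∀ t, 0 < t → t ≤ ε → t ≤ r →
      a + m * (Real.exp (-α * ‖y - z‖ ^ 2) - Real.exp (-α * R ^ 2)) ≤
        t⁻¹ * (u (y + t • e) - u y) := by
    intro t ht htε htr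
    set f : 𝔼 → ℝ := fun w => u (w + t • e) - u w - t * m * Real.exp (-α * ‖w - z‖ ^ 2) with hf
    set A : Set 𝔼 := closedBall z R ∩ {w | r ≤ ‖w - z‖} with hA
    have hAc : IsCompact A :=
      (isCompact_closedBall z R).inter_right (isClosed_le continuous_const (by fun_prop))
    have hfc : ContinuousOn f A := by
      intro w hw
      have h1 : ContinuousAt u w := (h.hasFDerivAt (hball hw.1)).continuousAt
      have h2 : ContinuousAt u (w + t • e) :=
        (h.hasFDerivAt (hseg t htε w hw.1 t ⟨ht.le, le_rfl⟩)).continuousAt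
      have h3 : ContinuousAt (fun w => u (w + t • e)) w :=
        ContinuousAt.comp (f := fun w : 𝔼 => w + t • e) h2 (by fun_prop)
      have h4 : ContinuousAt (fun w : 𝔼 => t * m * Real.exp (-α * ‖w - z‖ ^ 2)) w := by fun_prop
      exact ((h3.sub h1).sub h4).continuousWithinAt
    obtain ⟨y₀, hy₀, hmin⟩ := hAc.exists_isMinOn ⟨y, hy, hry⟩ hfc
    have hle : f y₀ ≤ f y := hmin ⟨hy, hry⟩
    have hexp : 0 < Real.exp (-α * R ^ 2) := Real.exp_pos _
    have hbd : t * a - t * m * Real.exp (-α * R ^ 2) ≤ f y₀ := by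
      have hd : ‖y₀ - z‖ ≤ R := by rw [← dist_eq_norm]; exact hy₀.1
      -- On the inner sphere the increment is at least $t(a+m)$, since for $t\le r$ the segment
      -- stays within $2r$ of the centre. On the outer sphere the bound $v\ge a$ suffices, and an
      -- interior minimum is excluded by the comparison.
      rcases eq_or_lt_of_le (show r ≤ ‖y₀ - z‖ from hy₀.2) with hr0 | hr0
      · have h1 : t * (a + m) ≤ u (y₀ + t • e) - u y₀ := by
          refine h.mul_le_sub ht.le (hseg t htε _ hy₀.1) fun s hs => ?_
          refine hmr _ ?_ (hseg t htε _ hy₀.1 s hs)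
          rw [mem_closedBall, dist_eq_norm, add_sub_right_comm]
          refine (norm_add_le _ _).trans ?_
          rw [← hr0, norm_smul, he, Real.norm_of_nonneg hs.1]
          linarith [hs.2]
        have h2 : Real.exp (-α * ‖y₀ - z‖ ^ 2) ≤ 1 := by
          rw [Real.exp_le_one_iff]; nlinarith [sq_nonneg ‖y₀ - z‖]
        have h3 : 0 < t * m := by positivity
        simp only [hf]
        nlinarith [mul_pos h3 hexp]
      · rcases eq_or_lt_of_le hd with hR0 | hR0
        · have h1 : t * a ≤ u (y₀ + t • e) - u y₀ :=
            h.mul_le_sub ht.le (hseg t htε _ hy₀.1) fun s hs =>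
              hv _ (hseg t htε _ hy₀.1 s hs)
          simp only [hf, hR0]
          linarith
        · exfalso
          refine h.not_isLocalMin_sub_exp (τ := t • e) hr (mul_pos ht hm) hα (hball hy₀.1)
            (hseg t htε _ hy₀.1 t ⟨ht.le, le_rfl⟩) hr0.le hd hbar (hmin.isLocalMin ?_)
          refine inter_mem (closedBall_mem_nhds_of_mem (by rwa [mem_ball, dist_eq_norm])) ?_
          have : ContinuousAt (fun w : 𝔼 => ‖w - z‖) y₀ := by fun_prop
          exact (this.eventually_const_lt hr0).mono fun w hw => hw.le
    rw [inv_mul_eq_div, le_div_iff₀ ht]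
    simp only [hf] at hle hbd
    linarith
  have hyΩ := hball hy
  have hder : HasDerivAt (fun s : ℝ => u (y + s • e)) (fderiv ℝ u y e) 0 := by
    simpa using h.hasDerivAt_line (y := y) (ξ := e) (s := 0) (by simpa using hyΩ)
  have htend := (hasDerivAt_iff_tendsto_slope_zero.1 hder).mono_left
    (nhdsWithin_mono 0 (fun s (hs : (0 : ℝ) < s) => hs.ne') : 𝓝[>] (0 : ℝ) ≤ _)
  refine ge_of_tendsto htend ?_
  filter_upwards [Ioc_mem_nhdsGT (lt_min hε hr)] with t ht
  simpa using hinc t ht.1 (ht.2.trans (min_le_left _ _)) (ht.2.trans (min_le_right _ _))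

/-- Propagation of positivity of a directional derivative along a chain of balls. -/
theorem chain_le_fderiv (h : IsConvexCMC Ω δ c u) {e z₀ z₁ : 𝔼} {a r R m α : ℝ} (he : ‖e‖ = 1)
    (hconv : Convex ℝ Ω) (hv : ∀ y ∈ Ω, a ≤ fderiv ℝ u y e) (hr : 0 < r) (hm : 0 < m)
    (hα : 0 < α) (hRr : 4 * r ≤ R)
    (hball₀ : closedBall z₀ (4 * r) ⊆ Ω) (hball₁ : closedBall z₁ (4 * r) ⊆ Ω)
    (hmr : ∀ y ∈ closedBall z₀ (2 * r), a + m ≤ fderiv ℝ u y e)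
    (hbar : n + 1 + 8 * c * R < 2 * δ * r ^ 2 * α) {N : ℕ} (hN : 0 < N)
    (hNr : ‖z₁ - z₀‖ ≤ N * r) :
    ∀ y ∈ closedBall z₁ (2 * r),
      a + m * (Real.exp (-α * (3 * r) ^ 2) - Real.exp (-α * (4 * r) ^ 2)) ^ N ≤
        fderiv ℝ u y e := by
  set κ := Real.exp (-α * (3 * r) ^ 2) - Real.exp (-α * (4 * r) ^ 2) with hκ
  have hκ0 : 0 < κ := by
    rw [hκ, sub_pos, Real.exp_lt_exp]
    have : 0 < α * r ^ 2 := by positivity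
    linarith
  have hκ1 : κ ≤ 1 := by
    have h1 : Real.exp (-α * (3 * r) ^ 2) ≤ 1 := by
      rw [Real.exp_le_one_iff]
      have : 0 < α * r ^ 2 := by positivity
      linarith
    linarith [Real.exp_pos (-α * (4 * r) ^ 2)]
  have hc : 0 ≤ c := h.nonneg (hball₀ (mem_closedBall_self (by positivity)))
  have hbar' : n + 1 + 8 * c * (4 * r) < 2 * δ * r ^ 2 * α := by
    have : 8 * c * (4 * r) ≤ 8 * c * R := by gcongr
    linarith
  set p : ℕ → 𝔼 := fun k => z₀ + ((k : ℝ) / N) • (z₁ - z₀) with hp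
  have hN' : (0 : ℝ) < N := by exact_mod_cast hN
  -- Convexity: a ball centred on the segment is swept out by parallel segments between the two end
  -- balls.
  have hpball : ∀ k ≤ N, closedBall (p k) (4 * r) ⊆ Ω := by
    intro k hk w hw
    have hk' : (k : ℝ) / N ≤ 1 := by rw [div_le_one hN']; exact_mod_cast hk
    have hd : w - p k ∈ closedBall (0 : 𝔼) (4 * r) := by
      simpa [dist_eq_norm] using hw
    have h0 : z₀ + (w - p k) ∈ Ω := hball₀ (by simpa [dist_eq_norm] using hd)
    have h1 : z₁ + (w - p k) ∈ Ω := hball₁ (by simpa [dist_eq_norm] using hd)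
    have := hconv.add_smul_sub_mem h0 h1 (t := (k : ℝ) / N) ⟨by positivity, hk'⟩
    convert this using 1
    rw [add_sub_add_right_eq_sub]
    simp only [hp]
    abel
  have hstep : ∀ k, dist (p (k + 1)) (p k) ≤ r := by
    intro k
    have : p (k + 1) - p k = (1 / (N : ℝ)) • (z₁ - z₀) := by
      simp only [hp]
      rw [add_sub_add_left_eq_sub, ← sub_smul]
      congr 1
      push_cast
      ring
    rw [dist_eq_norm, this, norm_smul, Real.norm_of_nonneg (by positivity), one_div,
      inv_mul_le_iff₀ hN']
    exact hNr
  have main : ∀ k ≤ N, ∀ y ∈ closedBall (p k) (2 * r), a + m * κ ^ k ≤ fderiv ℝ u y e := by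
    intro k
    induction k with
    | zero =>
      intro _ y hy
      have : p 0 = z₀ := by simp [hp]
      rw [this] at hy
      simpa using hmr y hy
    | succ k ih =>
      intro hk y hy
      have ih := ih (by omega)
      -- The next ball of radius $2r$ lies within $3r$ of the current centre, where the barrier
      -- vanishing at radius $4r$ has height at least $\kappa$.
      have hyd : dist y (p k) ≤ 3 * r := by
        have h1 : dist y (p (k + 1)) ≤ 2 * r := hy
        have := dist_triangle y (p (k + 1)) (p k)
        linarith [hstep k]
      have hpos : 0 < m * κ ^ k := by positivity
      have hsucc : m * κ ^ (k + 1) = m * κ ^ k * κ := by ring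
      rw [hsucc]
      rcases le_total (dist y (p k)) (2 * r) with h2 | h2
      · refine le_trans ?_ (ih y h2)
        nlinarith
      · have h3 := h.barrier_le_fderiv he hv hr hpos hα (hpball k (by omega))
          (fun y hy _ => ih y hy) hbar' (y := y) (by rw [mem_closedBall]; linarith)
          (by rw [← dist_eq_norm]; linarith)
        refine le_trans ?_ h3
        rw [hκ]
        have : ‖y - p k‖ ≤ 3 * r := by rwa [← dist_eq_norm]
        have : Real.exp (-α * (3 * r) ^ 2) ≤ Real.exp (-α * ‖y - p k‖ ^ 2) := by
          rw [Real.exp_le_exp]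
          have : α * ‖y - p k‖ ^ 2 ≤ α * (3 * r) ^ 2 := by gcongr
          linarith
        gcongr
  have hpN : p N = z₁ := by
    simp only [hp]
    rw [div_self hN'.ne', one_smul]; abel
  rw [← hpN]
  exact main N le_rfl

/-- Quantitative growth of a directional derivative along the inner normal at the touching point
of an interior ball. -/
theorem growth_le_fderiv (h : IsConvexCMC Ω δ c u) {e x ν : 𝔼} {a r ρ m α : ℝ} (he : ‖e‖ = 1)
    (hν : ‖ν‖ = 1) (hv : ∀ y ∈ Ω, a ≤ fderiv ℝ u y e) (hr : 0 < r) (hm : 0 < m) (hα : 0 < α)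
    (hrρ : r < ρ) (hball : ball (x + ρ • ν) ρ ⊆ Ω)
    (hmr : ∀ y ∈ closedBall (x + ρ • ν) (2 * r), a + m ≤ fderiv ℝ u y e)
    (hbar : n + 1 + 8 * c * ρ < 2 * δ * r ^ 2 * α) {s : ℝ} (hs : 0 < s) (hsr : s ≤ ρ - r) :
    a + m * (Real.exp (-α * (ρ - s) ^ 2) - Real.exp (-α * ρ ^ 2)) ≤
      fderiv ℝ u (x + s • ν) e := by
  have hc : 0 ≤ c := h.nonneg (hball (mem_ball_self (hr.trans hrρ)))
  have hnorm : ‖x + s • ν - (x + ρ • ν)‖ = ρ - s := by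
    rw [add_sub_add_left_eq_sub, ← sub_smul, norm_smul, hν, mul_one, Real.norm_eq_abs, abs_sub_comm,
      abs_of_nonneg (by linarith)]
  -- The barrier estimate needs closed balls inside $\Omega$, but the tangent ball may touch
  -- $\partial\Omega$. It is applied with $R<\rho$, and $R\to\rho$.
  have hlim : Tendsto
      (fun R : ℝ => a + m * (Real.exp (-α * (ρ - s) ^ 2) - Real.exp (-α * R ^ 2))) (𝓝[<] ρ)
      (𝓝 (a + m * (Real.exp (-α * (ρ - s) ^ 2) - Real.exp (-α * ρ ^ 2)))) := by
    have : ContinuousAt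
      (fun R : ℝ => a + m * (Real.exp (-α * (ρ - s) ^ 2) - Real.exp (-α * R ^ 2))) ρ := by
      fun_prop
    exact this.tendsto.mono_left nhdsWithin_le_nhds
  refine le_of_tendsto hlim ?_
  filter_upwards [Ioo_mem_nhdsLT (show ρ - s < ρ by linarith)] with R hR
  have hbar' : n + 1 + 8 * c * R < 2 * δ * r ^ 2 * α := by
    have : 8 * c * R ≤ 8 * c * ρ := by gcongr; exact hR.2.le
    linarith
  have := h.barrier_le_fderiv he hv hr hm hα
    ((closedBall_subset_ball hR.2).trans hball) (fun y hy _ => hmr y hy) hbar' (y := x + s • ν)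
    (by rw [mem_closedBall, dist_eq_norm, hnorm]; exact hR.1.le) (by rw [hnorm]; linarith)
  rwa [hnorm] at this

end IsConvexCMC

end Comparison

/-! ### Choice of uniform constants -/

section Constants

variable {n : ℕ}

local notation "𝔼" => EuclideanSpace ℝ (Fin n)

/-- A nonnegative directional derivative which is large somewhere grows at a uniform rate from
any boundary point with an interior ball of given radius. -/
theorem exists_uniform_growth {Ω : Set 𝔼} (hconv : Convex ℝ Ω) (hbdd : Bornology.IsBounded Ω)
    {x₀ : 𝔼} {r₁ δ ρ m : ℝ} (hr₁ : 0 < r₁) (hball : closedBall x₀ r₁ ⊆ Ω) (hδ : 0 < δ)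
    (hρ : 0 < ρ) (hm : 0 < m) :
    ∃ C > 0, ∃ m₁ > 0, ∃ α > 0, ∃ s₀ > 0, ∀ (c a : ℝ) (u : 𝔼 → ℝ) (e x ν : 𝔼),
      IsConvexCMC Ω δ c u → ‖e‖ = 1 → ‖ν‖ = 1 → ball (x + ρ • ν) ρ ⊆ Ω →
      (∀ y ∈ Ω, a ≤ fderiv ℝ u y e) → (∃ y ∈ Ω, a + m ≤ fderiv ℝ u y e) →
      c ≤ C ∧ ∀ s, 0 < s → s ≤ s₀ →
        a + m₁ * (Real.exp (-α * (ρ - s) ^ 2) - Real.exp (-α * ρ ^ 2)) ≤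
          fderiv ℝ u (x + s • ν) e := by
  obtain ⟨D, hD, hDΩ⟩ : ∃ D > 0, ∀ y ∈ Ω, ∀ z ∈ Ω, ‖y - z‖ ≤ D :=
    ⟨diam Ω + 1, by positivity, fun y hy z hz => by
      rw [← dist_eq_norm]; linarith [dist_le_diam_of_mem hbdd hy hz]⟩
  have hx₀ : x₀ ∈ Ω := hball (mem_closedBall_self hr₁.le)
  set C : ℝ := 4 / r₁ * (n + 1) / √δ ^ 3 with hC
  have hC0 : 0 < C := by positivity
  -- Since $v$ is Lipschitz with constant $c\le C$, moving a distance $\sigma(D+r_1)$ costs at most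
  -- $m/2$.
  set σ : ℝ := min 1 (m / (2 * C * (D + r₁))) with hσ
  have hσ0 : 0 < σ := by positivity
  have hσ1 : σ ≤ 1 := min_le_left _ _
  have hσC : C * (σ * (D + r₁)) ≤ m / 2 := by
    have : σ ≤ m / (2 * C * (D + r₁)) := min_le_right _ _
    rw [le_div_iff₀ (by positivity)] at this
    linarith
  set r : ℝ := min (σ * r₁) ρ / 8 with hr
  have hr0 : 0 < r := by positivity
  have hrσ : 4 * r ≤ σ * r₁ := by
    have : min (σ * r₁) ρ ≤ σ * r₁ := min_le_left _ _
    have : 0 < σ * r₁ := by positivity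
    linarith
  have hrρ : 8 * r ≤ ρ := by
    have : min (σ * r₁) ρ ≤ ρ := min_le_right _ _
    linarith
  -- Makes the barrier inequality hold for $C$ with margin 1, hence for every $c\le C$ and every
  -- outer radius up to $\rho$.
  set α : ℝ := (n + 2 + 8 * C * ρ) / (2 * δ * r ^ 2) with hα
  have hα0 : 0 < α := by positivity
  have hbarC : n + 1 + 8 * C * ρ < 2 * δ * r ^ 2 * α := by
    have : 2 * δ * r ^ 2 * α = n + 2 + 8 * C * ρ := by rw [hα]; field_simp
    linarith
  obtain ⟨N, hN0, hNr⟩ : ∃ N : ℕ, 0 < N ∧ D ≤ N * r := by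
    refine ⟨⌈D / r⌉₊, Nat.ceil_pos.2 (by positivity), ?_⟩
    rw [← div_le_iff₀ hr0]
    exact Nat.le_ceil _
  have hκ : 0 < Real.exp (-α * (3 * r) ^ 2) - Real.exp (-α * (4 * r) ^ 2) := by
    rw [sub_pos, Real.exp_lt_exp]
    have : 0 < α * r ^ 2 := by positivity
    linarith
  refine ⟨C, hC0, m / 2 * (Real.exp (-α * (3 * r) ^ 2) - Real.exp (-α * (4 * r) ^ 2)) ^ N,
    by positivity, α, hα0, ρ - r, by linarith, ?_⟩
  intro c a u e x ν h he hν hballx hv ⟨y, hy, hay⟩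
  have hcC : c ≤ C := by
    rw [hC, le_div_iff₀ (by positivity)]
    exact h.mul_sqrt_le hr₁ hball
  have hc0 : 0 ≤ c := h.nonneg hy
  refine ⟨hcC, fun s hs hs0 => ?_⟩
  have hbar : n + 1 + 8 * c * ρ < 2 * δ * r ^ 2 * α := by
    have : 8 * c * ρ ≤ 8 * C * ρ := by gcongr
    linarith
  -- The point $y$ may be close to $\partial\Omega$. Shrinking the fixed ball about $x_0$ towards
  -- $y$ by the factor $\sigma$ gives a ball in $\Omega$, of definite radius and still near $y$.
  set y₁ : 𝔼 := y + σ • (x₀ - y) with hy₁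
  have hnear : ∀ w ∈ closedBall y₁ (σ * r₁), w ∈ Ω ∧ ‖w - y‖ ≤ σ * (D + r₁) := by
    intro w hw
    have hw' : ‖w - y₁‖ ≤ σ * r₁ := by simpa [dist_eq_norm] using hw
    constructor
    · have hz : x₀ + σ⁻¹ • (w - y₁) ∈ Ω := by
        refine hball ?_
        rw [mem_closedBall, dist_eq_norm, add_sub_cancel_left, norm_smul, norm_inv,
          Real.norm_of_nonneg hσ0.le, inv_mul_le_iff₀ hσ0]
        exact hw'
      have := hconv.add_smul_sub_mem hy hz ⟨hσ0.le, hσ1⟩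
      convert this using 1
      rw [add_sub_right_comm, smul_add, smul_smul, mul_inv_cancel₀ hσ0.ne', one_smul, hy₁]
      abel
    · have h1 : ‖y₁ - y‖ ≤ σ * D := by
        rw [hy₁, add_sub_cancel_left, norm_smul, Real.norm_of_nonneg hσ0.le]
        gcongr
        exact hDΩ _ hx₀ _ hy
      calc ‖w - y‖ = ‖(w - y₁) + (y₁ - y)‖ := by congr 1; abel
        _ ≤ σ * r₁ + σ * D := (norm_add_le _ _).trans (add_le_add hw' h1)
        _ = σ * (D + r₁) := by ring
  have hstart : ∀ w ∈ closedBall y₁ (2 * r), a + m / 2 ≤ fderiv ℝ u w e := by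
    intro w hw
    obtain ⟨hwΩ, hwy⟩ := hnear w (closedBall_subset_closedBall (by linarith) hw)
    have h1 := (abs_le.1 (h.abs_fderiv_sub_le hconv hy hwΩ he)).1
    have h2 : c * ‖w - y‖ ≤ C * (σ * (D + r₁)) := by gcongr
    linarith
  have hb₀ : closedBall y₁ (4 * r) ⊆ Ω := fun w hw =>
    (hnear w (closedBall_subset_closedBall hrσ hw)).1
  have hb₁ : closedBall (x + ρ • ν) (4 * r) ⊆ Ω :=
    (closedBall_subset_ball (by linarith)).trans hballx
  have hfar := h.chain_le_fderiv he hconv hv hr0 (half_pos hm) hα0 (show 4 * r ≤ ρ by linarith)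
    hb₀ hb₁ hstart hbar hN0
    ((hDΩ _ (hb₁ (mem_closedBall_self (by positivity))) _
      (hb₀ (mem_closedBall_self (by positivity)))).trans hNr)
  exact h.growth_le_fderiv he hν hv hr0 (by positivity) hα0 (by linarith) hballx hfar hbar hs hs0

end Constants

/-! ### Solutions up to the boundary -/

section Solution

variable {n : ℕ} {Ω Ω' : Set (EuclideanSpace ℝ (Fin n))} {c : ℝ}
  {u : EuclideanSpace ℝ (Fin n) → ℝ}

local notation "𝔼" => EuclideanSpace ℝ (Fin n)

theorem inner_gradientUpTo (x ξ : 𝔼) :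
    inner ℝ (gradientUpTo Ω u x) ξ = fderivWithin ℝ u (closure Ω) x ξ := by
  simp [gradientUpTo, gradientWithin]

theorem fderivWithin_closure_eq (hΩ : IsOpen Ω) {F : Type*} [NormedAddCommGroup F]
    [NormedSpace ℝ F] (f : 𝔼 → F) {x : 𝔼} (hx : x ∈ Ω) :
    fderivWithin ℝ f (closure Ω) x = fderiv ℝ f x :=
  fderivWithin_of_mem_nhds (mem_of_superset (hΩ.mem_nhds hx) subset_closure)

theorem gradientUpTo_eq_gradient (hΩ : IsOpen Ω) {x : 𝔼} (hx : x ∈ Ω) :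
    gradientUpTo Ω u x = gradient u x := by
  rw [gradientUpTo, gradientWithin, gradient, fderivWithin_closure_eq hΩ u hx]

theorem fderivWithin_fderivWithin_closure_eq (hΩ : IsOpen Ω) {x : 𝔼} (hx : x ∈ Ω) :
    fderivWithin ℝ (fderivWithin ℝ u (closure Ω)) (closure Ω) x = hessian u x := by
  rw [fderivWithin_closure_eq hΩ _ hx, hessian]
  refine Filter.EventuallyEq.fderiv_eq ?_
  filter_upwards [hΩ.mem_nhds hx] with y hy using fderivWithin_closure_eq hΩ u hy

/-- The Riesz isomorphism of Euclidean space, as a linear map. -/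
noncomputable def dualToVector (n : ℕ) :
    (EuclideanSpace ℝ (Fin n) →L[ℝ] ℝ) →L[ℝ] EuclideanSpace ℝ (Fin n) :=
  LinearMap.mkContinuous
    { toFun := (InnerProductSpace.toDual ℝ (EuclideanSpace ℝ (Fin n))).symm
      map_add' := map_add _
      map_smul' := fun a f => by simp } 1 fun f => by simp

/-- The mean curvature operator in terms of the Hessian. -/
theorem divergence_normalized_gradient {G : 𝔼 → 𝔼} {G' : 𝔼 →L[ℝ] 𝔼}
    {B : 𝔼 →L[ℝ] 𝔼 →L[ℝ] ℝ} {x : 𝔼} (hG : HasFDerivAt G G' x)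
    (hB : ∀ ξ η, inner ℝ (G' ξ) η = B ξ η) (hlt : ‖G x‖ < 1) :
    divergence (fun y => (√(1 - ‖G y‖ ^ 2))⁻¹ • G y) x * √(1 - ‖G x‖ ^ 2) ^ 3 =
      (1 - ‖G x‖ ^ 2) * bilinTrace B + B (G x) (G x) := by
  have hX : 0 < 1 - ‖G x‖ ^ 2 := by nlinarith [norm_nonneg (G x)]
  have hsq : √(1 - ‖G x‖ ^ 2) ^ 2 = 1 - ‖G x‖ ^ 2 := Real.sq_sqrt hX.le
  have hpos : 0 < √(1 - ‖G x‖ ^ 2) := Real.sqrt_pos.2 hX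
  set S := √(1 - ‖G x‖ ^ 2) with hS
  have hsc := (hasDerivAt_inv hpos.ne').comp_hasFDerivAt x
    ((hG.norm_sq.const_sub 1).sqrt hX.ne')
  have hV := hsc.smul hG
  have hfd : fderiv ℝ (fun y => (√(1 - ‖G y‖ ^ 2))⁻¹ • G y) x = _ := hV.fderiv
  have hterm : ∀ i, (fderiv ℝ (fun y => (√(1 - ‖G y‖ ^ 2))⁻¹ • G y) x
      (EuclideanSpace.single i 1)) i = S⁻¹ * B (EuclideanSpace.single i 1)
        (EuclideanSpace.single i 1) + (S ^ 3)⁻¹ * (G x i *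
        B.flip (G x) (EuclideanSpace.single i 1)) := by
    intro i
    have h1 : (G' (EuclideanSpace.single i 1)) i =
        B (EuclideanSpace.single i 1) (EuclideanSpace.single i 1) := by
      rw [← hB]; simp [EuclideanSpace.inner_single_right]
    have h2 : inner ℝ (G x) (G' (EuclideanSpace.single i 1)) =
        B (EuclideanSpace.single i 1) (G x) := by
      rw [← hB, real_inner_comm]
    rw [hfd]
    simp [h1, h2, ← hS]
    field_simp
  rw [divergence, Finset.sum_congr rfl fun i _ => hterm i, Finset.sum_add_distrib,
    ← Finset.mul_sum, ← Finset.mul_sum, sum_mul_apply_single, ContinuousLinearMap.flip_apply,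
    ← hsq, bilinTrace]
  field_simp

/-- On each line the derivative of $u$ is monotone, so its derivative is nonnegative. -/
theorem hessian_nonneg_of_convexOn (hΩ : IsOpen Ω) (hu : ContDiffOn ℝ 2 u Ω)
    (hc : ConvexOn ℝ Ω u) {y : 𝔼} (hy : y ∈ Ω) (ξ : 𝔼) : 0 ≤ hessian u y ξ ξ := by
  set S : Set ℝ := {s | y + s • ξ ∈ Ω} with hS
  have hSo : IsOpen S := hΩ.preimage (by fun_prop : Continuous fun s : ℝ => y + s • ξ)
  have h0 : (0 : ℝ) ∈ S := by simpa [hS] using hy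
  have hcg : ConvexOn ℝ S fun s : ℝ => u (y + s • ξ) := by
    have := hc.comp_affineMap (AffineMap.lineMap y (y + ξ) : ℝ →ᵃ[ℝ] 𝔼)
    have heq : ∀ s : ℝ, (AffineMap.lineMap y (y + ξ) : ℝ →ᵃ[ℝ] 𝔼) s = y + s • ξ := by
      intro s; simp [AffineMap.lineMap_apply, add_comm]
    have hset : (AffineMap.lineMap y (y + ξ) : ℝ →ᵃ[ℝ] 𝔼) ⁻¹' Ω = S := by
      ext s; rw [mem_preimage, heq]; rfl
    have hfun : u ∘ (AffineMap.lineMap y (y + ξ) : ℝ →ᵃ[ℝ] 𝔼) = fun s : ℝ => u (y + s • ξ) := by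
      ext s; rw [Function.comp_apply, heq]
    rw [hset, hfun] at this
    exact this
  have hline : ∀ s : ℝ, HasDerivAt (fun s : ℝ => y + s • ξ) ξ s := fun s => by
    simpa using ((hasDerivAt_id s).smul_const ξ).const_add y
  have hd : ∀ s ∈ S, HasDerivAt (fun s : ℝ => u (y + s • ξ)) (fderiv ℝ u (y + s • ξ) ξ) s :=
    fun s hs => (((hu.contDiffAt (hΩ.mem_nhds hs)).differentiableAt
      (by norm_num)).hasFDerivAt).comp_hasDerivAt s (hline s)
  have hmono : MonotoneOn (fun s : ℝ => fderiv ℝ u (y + s • ξ) ξ) S :=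
    (hcg.monotoneOn_deriv fun s hs => (hd s hs).differentiableAt).congr
      fun s hs => (hd s hs).deriv
  have hdd : HasDerivAt (fun s : ℝ => fderiv ℝ u (y + s • ξ) ξ) (hessian u y ξ ξ) 0 := by
    have h1 : HasFDerivAt (fderiv ℝ u) (hessian u y) y :=
      (((hu.contDiffAt (hΩ.mem_nhds hy)).fderiv_right (m := 1) (by norm_num)).differentiableAt
        (by norm_num)).hasFDerivAt
    have h2 : HasFDerivAt (fun z => fderiv ℝ u z ξ) ((hessian u y).flip ξ) y := by
      simpa using h1.clm_apply (hasFDerivAt_const ξ y)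
    have h3 : HasFDerivAt (fun z => fderiv ℝ u z ξ) ((hessian u y).flip ξ) (y + (0 : ℝ) • ξ) := by
      simpa using h2
    exact h3.comp_hasDerivAt 0 (hline 0)
  have := hmono.derivWithin_nonneg (x := 0)
  rwa [derivWithin_of_isOpen hSo h0, hdd.deriv] at this

theorem uniqueDiffOn_closure (hΩ : IsUniformlyConvexDomain Ω) : UniqueDiffOn ℝ (closure Ω) :=
  uniqueDiffOn_convex hΩ.convex.closure
    (hΩ.nonempty.mono (interior_maximal subset_closure hΩ.isOpen))

theorem IsStrictlyConvexSolution.contDiffOn_fderivWithin (h : IsStrictlyConvexSolution Ω Ω' c u)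
    (hΩ : IsUniformlyConvexDomain Ω) :
    ContDiffOn ℝ 1 (fderivWithin ℝ u (closure Ω)) (closure Ω) :=
  h.contDiffOn.fderivWithin (uniqueDiffOn_closure hΩ) (by norm_num)

theorem IsStrictlyConvexSolution.isConvexCMC (h : IsStrictlyConvexSolution Ω Ω' c u)
    (hΩ : IsUniformlyConvexDomain Ω) {δ : ℝ} (hδ : 0 < δ)
    (hΩ' : ∀ q ∈ Ω', δ ≤ 1 - ‖q‖ ^ 2) : IsConvexCMC Ω δ c u := by
  have hu : ContDiffOn ℝ 2 u Ω := h.contDiffOn.mono subset_closure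
  have hG : ∀ y ∈ Ω, gradientUpTo Ω u y = gradient u y := fun y hy =>
    gradientUpTo_eq_gradient hΩ.isOpen hy
  refine ⟨hΩ.isOpen, hu, fun y hy => hessian_nonneg_of_convexOn hΩ.isOpen hu
    h.strictConvexOn.convexOn hy, hδ, fun y hy => ?_, fun y hy => ?_⟩
  · refine hΩ' _ ?_
    rw [← h.image_gradient, ← hG y hy]
    exact mem_image_of_mem _ hy
  · have hat := hu.contDiffAt (hΩ.isOpen.mem_nhds hy)
    have h1 : HasFDerivAt (fderiv ℝ u) (hessian u y) y :=
      ((hat.fderiv_right (m := 1) (by norm_num)).differentiableAt (by norm_num)).hasFDerivAt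
    have h2 : HasFDerivAt (gradientUpTo Ω u)
        ((dualToVector n).comp (hessian u y)) y := by
      refine HasFDerivAt.congr_of_eventuallyEq
        ((ContinuousLinearMap.hasFDerivAt _).comp y h1) ?_
      filter_upwards [hΩ.isOpen.mem_nhds hy] with z hz
      rw [hG z hz]
      rfl
    have := divergence_normalized_gradient (B := hessian u y) h2
      (fun ξ η => InnerProductSpace.toDual_symm_apply)
      (h.spacelike y hy)
    rw [h.equation y hy, hG y hy] at this
    exact this.symm

/-- The gradient maps the boundary of the domain into the boundary of the image. -/
theorem IsStrictlyConvexSolution.gradientUpTo_mem_frontier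
    (h : IsStrictlyConvexSolution Ω Ω' c u) (hΩ : IsUniformlyConvexDomain Ω)
    (hΩ' : IsUniformlyConvexDomain Ω') {x : 𝔼} (hx : x ∈ frontier Ω) :
    gradientUpTo Ω u x ∈ frontier Ω' := by
  have hxc : x ∈ closure Ω := frontier_subset_closure hx
  have hcont : ContinuousOn (fderivWithin ℝ u (closure Ω)) (closure Ω) :=
    (h.contDiffOn_fderivWithin hΩ).continuousOn
  rw [hΩ'.isOpen.frontier_eq]
  constructor
  · have hGc : ContinuousOn (gradientUpTo Ω u) (closure Ω) :=
      (LinearIsometryEquiv.continuous _).comp_continuousOn hcont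
    have := hGc.image_closure (mem_image_of_mem _ hxc)
    rwa [h.image_gradient] at this
  · rw [← h.image_gradient]
    rintro ⟨y, hy, hyx⟩
    have hxΩ : x ∉ Ω := by rw [hΩ.isOpen.frontier_eq] at hx; exact hx.2
    have hne : x - y ≠ 0 := sub_ne_zero.2 fun hxy => hxΩ (hxy ▸ hy)
    have hmem : ∀ s ∈ Ico (0 : ℝ) 1, y + s • (x - y) ∈ Ω := by
      intro s hs
      have := hΩ.convex.combo_interior_closure_mem_interior (x := y) (y := x) (a := 1 - s)
        (b := s) (by rwa [hΩ.isOpen.interior_eq]) hxc (by linarith [hs.2]) hs.1 (by ring)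
      rw [hΩ.isOpen.interior_eq] at this
      convert this using 1
      module
    have hsc : StrictConvexOn ℝ (Ico (0 : ℝ) 1) fun s => u (y + s • (x - y)) := by
      refine ⟨convex_Ico 0 1, fun s hs t ht hst p q hp hq hpq => ?_⟩
      have := h.strictConvexOn.2 (hmem s hs) (hmem t ht) (fun heq => hst
        (smul_left_injective ℝ hne (add_left_cancel heq))) hp hq hpq
      convert this using 2
      simp only [smul_eq_mul]
      rw [eq_sub_of_add_eq hpq]
      module
    have hd : ∀ s ∈ Ico (0 : ℝ) 1, HasDerivAt (fun s : ℝ => u (y + s • (x - y)))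
        (fderivWithin ℝ u (closure Ω) (y + s • (x - y)) (x - y)) s := by
      intro s hs
      have hline : HasDerivAt (fun s : ℝ => y + s • (x - y)) (x - y) s := by
        simpa using ((hasDerivAt_id s).smul_const (x - y)).const_add y
      rw [fderivWithin_closure_eq hΩ.isOpen u (hmem s hs)]
      have hdiff := ((h.contDiffOn.mono subset_closure).contDiffAt
        (hΩ.isOpen.mem_nhds (hmem s hs))).differentiableAt (by norm_num)
      exact hdiff.hasFDerivAt.comp_hasDerivAt s hline
    have hmono := hsc.strictMonoOn_deriv fun s hs => (hd s hs).differentiableAt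
    have hcomp : ContinuousOn
        (fun s : ℝ => fderivWithin ℝ u (closure Ω) (y + s • (x - y)) (x - y)) (Icc 0 1) := by
      refine ContinuousOn.clm_apply (hcont.comp (by fun_prop) fun s hs => ?_) continuousOn_const
      exact hΩ.convex.closure.add_smul_sub_mem (subset_closure hy) hxc hs
    -- Passing to the endpoint loses strictness, so the midpoint is kept: the slope at $x$ is at
    -- least that at the midpoint, which exceeds that at $y$. Equal gradients at $x$ and $y$ are
    -- thus impossible.
    have hlim : fderivWithin ℝ u (closure Ω) (y + (1 / 2 : ℝ) • (x - y)) (x - y) ≤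
        fderivWithin ℝ u (closure Ω) (y + (1 : ℝ) • (x - y)) (x - y) := by
      have ht := (hcomp 1 (by norm_num)).mono_left
        (nhdsWithin_mono (1 : ℝ) (Ioo_subset_Icc_self : Ioo (0 : ℝ) 1 ⊆ _))
      rw [nhdsWithin_Ioo_eq_nhdsLT one_pos] at ht
      refine ge_of_tendsto ht ?_
      filter_upwards [Ioo_mem_nhdsLT (show (1 / 2 : ℝ) < 1 by norm_num)] with s hs
      have h1 := hmono.monotoneOn (show (1 / 2 : ℝ) ∈ Ico (0 : ℝ) 1 by norm_num)
        (show s ∈ Ico (0 : ℝ) 1 from ⟨by linarith [hs.1], hs.2⟩) hs.1.le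
      rwa [(hd _ (by norm_num)).deriv, (hd s ⟨by linarith [hs.1], hs.2⟩).deriv] at h1
    have hlt := hmono (show (0 : ℝ) ∈ Ico (0 : ℝ) 1 by norm_num)
      (show (1 / 2 : ℝ) ∈ Ico (0 : ℝ) 1 by norm_num) (by norm_num)
    rw [(hd _ (by norm_num)).deriv, (hd _ (by norm_num)).deriv] at hlt
    simp only [zero_smul, add_zero, one_smul, add_sub_cancel] at hlt hlim
    rw [← inner_gradientUpTo, ← inner_gradientUpTo] at hlt
    rw [← inner_gradientUpTo, ← inner_gradientUpTo] at hlim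
    rw [hyx] at hlt
    linarith

/-- The gradient of a defining function at a boundary point is an inner normal. -/
theorem IsDefiningFunction.inner_sub_gradient_nonneg {h : 𝔼 → ℝ} (hh : IsDefiningFunction Ω' h)
    (hΩ' : IsUniformlyConvexDomain Ω') {p q : 𝔼} (hp : p ∈ frontier Ω') (hq : q ∈ Ω') :
    0 ≤ inner ℝ (q - p) (gradient h p) := by
  rw [real_inner_comm, inner_gradient_eq_fderiv]
  have hline : HasDerivAt (fun s : ℝ => p + s • (q - p)) (q - p) 0 := by
    simpa using ((hasDerivAt_id (0 : ℝ)).smul_const (q - p)).const_add p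
  have hd : HasDerivAt (fun s : ℝ => h (p + s • (q - p))) (fderiv ℝ h p (q - p)) 0 := by
    have h1 : HasFDerivAt h (fderiv ℝ h p) (p + (0 : ℝ) • (q - p)) := by
      simpa using (hh.smooth.differentiable (by simp)).differentiableAt.hasFDerivAt
    exact h1.comp_hasDerivAt (0 : ℝ) hline
  have hp0 : h p ≤ 0 := by
    rw [hΩ'.isOpen.frontier_eq] at hp
    refine not_lt.1 fun hpos => hp.2 ?_
    rw [hh.eq_pos]; exact hpos
  refine hd.hasDerivWithinAt (s := Ioi 0) |>.le_of_eventually_le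
    (hasDerivWithinAt_const (0 : ℝ) (Ioi 0) (0 : ℝ)) ?_
  -- The open segment from $p$ to $q$ lies in $\tilde\Omega$, where $h>0\ge h(p)$.
  filter_upwards [Ioo_mem_nhdsGT (zero_lt_one' ℝ)] with s hs
  have hmem : p + s • (q - p) ∈ Ω' := by
    have := hΩ'.convex.combo_interior_closure_mem_interior (x := q) (y := p) (a := s)
      (b := 1 - s) (by rwa [hΩ'.isOpen.interior_eq]) (frontier_subset_closure hp) hs.1
      (by linarith [hs.2]) (by ring)
    rw [hΩ'.isOpen.interior_eq] at this
    convert this using 1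
    module
  have : 0 < h (p + s • (q - p)) := by rw [hh.eq_pos] at hmem; exact hmem
  simp only [zero_smul, add_zero]
  linarith

/-- Differentiating a directional derivative of the solution along a ray entering the domain. -/
theorem IsStrictlyConvexSolution.hasDerivWithinAt_ray (h : IsStrictlyConvexSolution Ω Ω' c u)
    (hΩ : IsUniformlyConvexDomain Ω) {x ξ : 𝔼} (e : 𝔼) (hx : x ∈ frontier Ω)
    (hξ : ∀ᶠ s in 𝓝[>] (0 : ℝ), x + s • ξ ∈ Ω) :
    HasDerivWithinAt (fun s : ℝ => fderivWithin ℝ u (closure Ω) (x + s • ξ) e)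
      (fderivWithin ℝ (fderivWithin ℝ u (closure Ω)) (closure Ω) x ξ e) (Ioi 0) 0 := by
  have hxc := frontier_subset_closure hx
  set A := fderivWithin ℝ (fderivWithin ℝ u (closure Ω)) (closure Ω) x with hA
  have h1 : HasFDerivWithinAt (fderivWithin ℝ u (closure Ω)) A (closure Ω) x :=
    ((h.contDiffOn_fderivWithin hΩ).differentiableOn (by norm_num) x hxc).hasFDerivWithinAt
  have h2 : HasFDerivWithinAt (fun y => fderivWithin ℝ u (closure Ω) y e) (A.flip e)
      (closure Ω) x := by
    simpa using h1.clm_apply (hasFDerivWithinAt_const e x (closure Ω))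
  have h3 : HasFDerivWithinAt (fun y => fderivWithin ℝ u (closure Ω) y e) (A.flip e)
      (closure Ω) (x + (0 : ℝ) • ξ) := by simpa using h2
  have hline : HasDerivAt (fun s : ℝ => x + s • ξ) ξ 0 := by
    simpa using ((hasDerivAt_id (0 : ℝ)).smul_const ξ).const_add x
  have h4 := h3.comp_hasDerivWithinAt (0 : ℝ) (s := {s : ℝ | x + s • ξ ∈ closure Ω})
    hline.hasDerivWithinAt fun s hs => hs
  exact h4.mono_of_mem_nhdsWithin (hξ.mono fun s hs => subset_closure hs)

end Solution

/-! ### The obliqueness estimate -/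

theorem lemma3p4 {n : ℕ} (Ω Ω' : Set (EuclideanSpace ℝ (Fin n)))
    (hΩ : IsUniformlyConvexDomain Ω) (hΩ' : IsUniformlyConvexDomain Ω')
    (hball : closure Ω' ⊆ Metric.ball (0 : EuclideanSpace ℝ (Fin n)) 1) :
    ∃ C₁ : ℝ, 0 < C₁ ∧
      ∀ (c : ℝ) (u h : EuclideanSpace ℝ (Fin n) → ℝ),
        IsStrictlyConvexSolution Ω Ω' c u → IsDefiningFunction Ω' h →
        ∀ x ∈ frontier Ω, ∀ ν : EuclideanSpace ℝ (Fin n), IsInnerUnitNormal Ω x ν →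
          1 / C₁ ≤ inner ℝ (gradient h (gradientUpTo Ω u x)) ν := by
  obtain ⟨x₀, hx₀⟩ := hΩ.nonempty
  obtain ⟨r₁, hr₁, hb₁⟩ := nhds_basis_closedBall.mem_iff.1 (hΩ.isOpen.mem_nhds hx₀)
  obtain ⟨q₀, hq₀⟩ := hΩ'.nonempty
  obtain ⟨r₀, hr₀, hb₀⟩ := nhds_basis_closedBall.mem_iff.1 (hΩ'.isOpen.mem_nhds hq₀)
  obtain ⟨ρ, hρ, hbρ⟩ := hΩ.exists_interior_ball
  obtain ⟨δ, hδ, hδΩ'⟩ : ∃ δ > 0, ∀ q ∈ Ω', δ ≤ 1 - ‖q‖ ^ 2 := by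
    obtain ⟨τ, hτ, hτb⟩ := exists_lt_subset_ball isClosed_closure hball
    have hτ0 : 0 ≤ τ := by
      have := hτb (subset_closure hq₀)
      rw [mem_ball_zero_iff] at this
      exact (norm_nonneg _).trans this.le
    refine ⟨1 - τ ^ 2, by nlinarith, fun q hq => ?_⟩
    have := hτb (subset_closure hq)
    rw [mem_ball_zero_iff] at this
    gcongr
  obtain ⟨C, hC, m₁, hm₁, α, hα, s₀, hs₀, hgrowth⟩ :=
    exists_uniform_growth hΩ.convex hΩ.isBounded hr₁ hb₁ hδ hρ hr₀
  -- The derivative at $s=0$ of the growth bound along the normal; it bounds $A(\nu,e)$ from below.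
  set l₀ : ℝ := m₁ * (Real.exp (-α * ρ ^ 2) * (2 * α * ρ)) with hl₀
  have hl₀pos : 0 < l₀ := by positivity
  refine ⟨C / l₀, by positivity, ?_⟩
  intro c u h hu hh x hx ν hν
  set p := gradientUpTo Ω u x with hp
  set e := gradient h p with he
  have hpf : p ∈ frontier Ω' := hu.gradientUpTo_mem_frontier hΩ hΩ' hx
  have he1 : ‖e‖ = 1 := hh.norm_gradient p hpf
  have hν1 := hν.norm_eq_one
  have hxc := frontier_subset_closure hx
  have hcmc := hu.isConvexCMC hΩ hδ hδΩ'
  set K := closure Ω with hK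
  set a : ℝ := fderivWithin ℝ u K x e with ha
  have hgrad : ∀ y ∈ Ω, gradientUpTo Ω u y ∈ Ω' := fun y hy => by
    rw [← hu.image_gradient]; exact mem_image_of_mem _ hy
  have hvpos : ∀ y ∈ Ω, a ≤ fderiv ℝ u y e := by
    intro y hy
    have := hh.inner_sub_gradient_nonneg hΩ' hpf (hgrad y hy)
    rw [inner_sub_left, inner_gradientUpTo, hp, inner_gradientUpTo,
      fderivWithin_closure_eq hΩ.isOpen u hy] at this
    linarith
  have hvbig : ∃ y ∈ Ω, a + r₀ ≤ fderiv ℝ u y e := by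
    obtain ⟨y, hy, hyq⟩ : q₀ ∈ gradientUpTo Ω u '' Ω := by rw [hu.image_gradient]; exact hq₀
    refine ⟨y, hy, ?_⟩
    -- The point of the ball about $q_0$ lying farthest in direction $-e$ still satisfies the
    -- half-space inequality at $p$, so $\langle q_0-p,e\rangle\ge r_0$.
    have hq : q₀ - r₀ • e ∈ Ω' := by
      refine hb₀ ?_
      rw [mem_closedBall, dist_eq_norm, sub_sub_cancel_left, norm_neg, norm_smul, he1, mul_one,
        Real.norm_of_nonneg hr₀.le]
    have := hh.inner_sub_gradient_nonneg hΩ' hpf hq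
    rw [inner_sub_left, inner_sub_left, real_inner_smul_left, ← he, real_inner_self_eq_norm_sq,
      he1, ← hyq, inner_gradientUpTo, hp, inner_gradientUpTo,
      fderivWithin_closure_eq hΩ.isOpen u hy] at this
    linarith
  obtain ⟨hcC, hgr⟩ := hgrowth c a u e x ν hcmc he1 hν1 (hbρ x hx ν hν) hvpos hvbig
  set A := fderivWithin ℝ (fderivWithin ℝ u K) K x with hA
  have hsymm : ∀ ξ η, A ξ η = A η ξ := fun ξ η =>
    ((hu.contDiffOn x hxc).isSymmSndFDerivWithinAt (by simp) (uniqueDiffOn_closure hΩ)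
      (closure_mono (interior_maximal subset_closure hΩ.isOpen) hxc) hxc).eq ξ η
  have hAcont : ∀ ξ : EuclideanSpace ℝ (Fin n), ContinuousOn
      (fun y => fderivWithin ℝ (fderivWithin ℝ u K) K y ξ ξ) K := fun ξ =>
    (((hu.contDiffOn_fderivWithin hΩ).continuousOn_fderivWithin (uniqueDiffOn_closure hΩ)
      (by norm_num)).clm_apply continuousOn_const).clm_apply continuousOn_const
  have hApos : ∀ ξ, 0 ≤ A ξ ξ := fun ξ =>
    le_on_closure (f := fun _ => (0 : ℝ)) (fun y hy => by
      rw [fderivWithin_fderivWithin_closure_eq hΩ.isOpen hy]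
      exact hcmc.hessian_nonneg y hy ξ) continuousOn_const (hAcont ξ) hxc
  have hAν : A ν ν ≤ c :=
    le_on_closure (g := fun _ => c) (fun y hy => by
      rw [fderivWithin_fderivWithin_closure_eq hΩ.isOpen hy]
      simpa [hν1] using (le_abs_self _).trans (hcmc.abs_hessian_le hy ν ν))
      (hAcont ν) continuousOn_const hxc
  have hνν : 0 < inner ℝ ν ν := by rw [real_inner_self_eq_norm_sq, hν1]; norm_num
  -- As $v\ge v(x)$, its derivative at $x$ is nonnegative in every inward direction.
  have hAe : ∀ ξ, A.flip e ξ = A.flip e ν * inner ℝ ν ξ := by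
    refine apply_eq_mul_inner_of_nonneg hν1 fun ξ hξ => ?_
    have hmem := hν.eventually_mem hΩ.isOpen hx hξ
    refine (hu.hasDerivWithinAt_ray hΩ e hx hmem).le_of_eventually_le
      (hasDerivWithinAt_const (0 : ℝ) (Ioi 0) (0 : ℝ)) ?_
    filter_upwards [hmem] with s hs
    have := hvpos _ hs
    rw [fderivWithin_closure_eq hΩ.isOpen u hs]
    simp only [zero_smul, add_zero]
    linarith
  have hl : l₀ ≤ A ν e := by
    have hmem := hν.eventually_mem hΩ.isOpen hx hνν
    have hexp : HasDerivAt
        (fun s : ℝ => m₁ * (Real.exp (-α * (ρ - s) ^ 2) - Real.exp (-α * ρ ^ 2))) l₀ 0 := by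
      have h1 : HasDerivAt (fun s : ℝ => -α * (ρ - s) ^ 2) (2 * α * ρ) 0 := by
        refine ((((hasDerivAt_id (0 : ℝ)).const_sub ρ).pow 2).const_mul (-α)).congr_deriv ?_
        simp
        ring
      refine ((h1.exp.sub_const (Real.exp (-α * ρ ^ 2))).const_mul m₁).congr_deriv ?_
      simp [hl₀]
    refine (hu.hasDerivWithinAt_ray hΩ e hx hmem).le_of_eventually_le
      hexp.hasDerivWithinAt ?_
    filter_upwards [hmem, Ioc_mem_nhdsGT hs₀] with s hs hs'
    have := hgr s hs'.1 hs'.2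
    rw [fderivWithin_closure_eq hΩ.isOpen u hs]
    simp only [zero_smul, add_zero, sub_zero, sub_self, mul_zero]
    linarith
  have hcs := sq_apply_le_of_symm_of_nonneg A hsymm hApos ν e
  have hee : A e e = A ν e * inner ℝ ν e := by simpa using hAe e
  have hc0 : 0 ≤ c := hcmc.nonneg hx₀
  rw [real_inner_comm, one_div_div, div_le_iff₀ hC]
  set t : ℝ := inner ℝ ν e
  have hlpos : 0 < A ν e := hl₀pos.trans_le hl
  -- Cauchy-Schwarz with $A(e,e)=A(\nu,e)t$ and $A(\nu,\nu)\le c$; one factor $A(\nu,e)>0$ is then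
  -- cancelled.
  have h1 : A ν e ^ 2 ≤ c * (A ν e * t) := by
    rw [← hee]
    exact hcs.trans (mul_le_mul_of_nonneg_right hAν (hApos e))
  have h2 : A ν e ≤ c * t := by
    refine le_of_mul_le_mul_left ?_ hlpos
    linarith
  have ht : 0 < t := by
    by_contra! ht
    linarith [mul_nonpos_of_nonneg_of_nonpos hc0 ht]
  have h3 : c * t ≤ C * t := by gcongr
  linarith
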